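/- **Conventions.** A *biquandle* is a set $X$ with two binary operations $\underline{*},\overline{*}$ such that (1) $x\,\underline{*}\,x=x\,\overline{*}\,x$; (2) the maps $\bullet\,\underline{*}\,x$, $\bullet\,\overline{*}\,x$ on $X$ and $(x,y)\mapsto(y\,\overline{*}\,x,\;x\,\underline{*}\,y)$ on $X\times X$ are bijective; (3) $(x\underline{*}y)\underline{*}(z\underline{*}y)=(x\underline{*}z)\underline{*}(y\overline{*}z)$, $(x\overline{*}y)\overline{*}(z\overline{*}y)=(x\overline{*}z)\overline{*}(y\underline{*}z)$, $(x\underline{*}y)\overline{*}(z\underline{*}y)=(x\overline{*}z)\underline{*}(y\overline{*}z)$. Write $\overline{*}^{-1}$ for the inverse operation: $(x\,\overline{*}\,y)\,\overline{*}^{-1}y=x$. Let $\mathcal Q(X)$ be the set $X$ with the quandle operation $x*y=(x\,\underline{*}\,y)\,\overline{*}^{-1}y$; a quandle is regarded as a biquandle with $\underline{*}=*$ and $x\,\overline{*}\,y=x$. Let $k\colon X\to X$ be the bijection with $k(x)\,\overline{*}\,k(x)=x$, and $$\mathrm{As}(X)=\langle x\ (x\in X)\mid x\cdot(y\,\overline{*}\,x)=y\cdot(x\,\underline{*}\,y)\rangle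 .$$ Let $D\subset\mathbb R^2$ be an oriented link diagram. The normal vector of a strand is its tangent vector turned by $+90^\circ$. An $X$-coloring is a map $\mathcal C\colon\mathcal{SA}(D)\to X$ on the semi-arcs such that at every crossing $\mathcal C(\sigma_i)\,\underline{*}\,\mathcal C(\sigma_j)=\mathcal C(\sigma_k)$ and $\mathcal C(\sigma_j)\,\overline{*}\,\mathcal C(\sigma_i)=\mathcal C(\sigma_l)$, where the normal vector of the over-strand points from the side of the under-semi-arc $\sigma_i$ to that of the under-semi-arc $\sigma_k$, and the normal vector of the under-strand points from the side of the over-semi-arc $\sigma_j$ to that of the over-semi-arc $\sigma_l$. For a quandle $Q$, a $Q$-coloring is a map on the arcs of $D$ with $\mathcal C(\alpha_i)*\mathcal C(\alpha_j)=\mathcal C(\alpha_k)$ for the under-arcs $\alpha_i,\alpha_k$ (on the sides as before) and the over-arc $\alpha_j$; it is also regarded as a map on the semi-arcs. Let $\mathrm{Col}_X(D)$, $\mathrm{Col}_Q(D)$ be the sets of colorings. The region coloring $\mathcal C^R\colon\mathcal R(D)\to\mathrm{As}(X)$ of a coloring $\mathcal C$ is the unique map with value $e$ on the unbounded region and $\mathcal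 C^R(R_1)\cdot\mathcal C(\sigma)=\mathcal C^R(R_2)$ whenever the normal vector of $\sigma$ points from the region $R_1=:\rho_\sigma$ to $R_2$; the shadow coloring is $\mathcal C^S(\sigma)=(\mathcal C^R(\rho_\sigma),\mathcal C(\sigma))\in\mathrm{As}(X)\times X$. **The map $\Psi$.** Let $W(D)$ be the diagram obtained by putting $-D^v$ ($D$ with orientation and all crossings reversed), slightly pushed in the direction of the normal vectors of $D$, behind $D$. Cut $D$ by horizontal levels into strips, each containing one crossing, one local maximum or one local minimum; a neighborhood of each level is a trivial tangle of vertical strings. For $\mathcal C\in\mathrm{Col}_{\mathcal Q(X)}(D)$ let $E\in\mathrm{Col}_X(W(D))$ be the coloring in which, at every level, both strings parallel to a string of $D$ have the color given by $\mathcal C$. In the neighborhood of each level, pull $-D^v$ away by Reidemeister moves of type II: move its leftmost string behind all other strings to the far right, then the second one to the left of the first, and so on. The coloring induced by $E$ then gives colors to the remaining strings of $D$ at that level; these are the colors of the coloring $\Psi(\mathcal C)$. **The maps $\psi,\psi_{\mathrm{As}}$.** Define $\psi\colon\mathrm{As}(\mathcal Q(X))\times\mathcal Q(X)\to X$ and $\psi_{\mathrm{As}}\colon\mathrm{As}(\mathcal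 Q(X))\to\mathrm{As}(X)$ by $$\psi(e,a)=a,\qquad \psi(p\cdot b,a)=\psi(p,a)\,\overline{*}\,\psi(p,b),\qquad \psi(p\cdot b^{-1},a)=\psi(p,a)\,\overline{*}^{-1}k(\psi(p,b)),$$ $$\psi_{\mathrm{As}}(e)=e,\qquad \psi_{\mathrm{As}}(p\cdot a)=\psi_{\mathrm{As}}(p)\cdot\psi(p,a),\qquad \psi_{\mathrm{As}}(p\cdot a^{-1})=\psi_{\mathrm{As}}(p)\cdot\psi(p\cdot a^{-1},a)^{-1},$$ and let $\tilde\psi(p,a)=(\psi_{\mathrm{As}}(p),\psi(p,a))$. **Proposition.** For every biquandle $X$ and every oriented link diagram $D$, the construction above gives a well-defined bijection $\Psi\colon\mathrm{Col}_{\mathcal Q(X)}(D)\to\mathrm{Col}_X(D)$, and for every $\mathcal C\in\mathrm{Col}_{\mathcal Q(X)}(D)$ $$(\Psi(\mathcal C))^S=\tilde\psi\circ\mathcal C^S\qquad\text{as maps }\mathcal{SA}(D)\to\mathrm{As}(X)\times X .$$ -/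

import Mathlib

universe u

namespace KnotColor

/-! ### Biquandles -/

/-- A biquandle: `ust x y` is the operation `x` underline-star `y`, and `ost x y` is
`x` overline-star `y`. -/
class Biquandle (X : Type u) where
  ust : X → X → X
  ost : X → X → X
  under_self : ∀ x, ust x x = ost x x
  under_bij : ∀ y, Function.Bijective fun x => ust x y
  over_bij : ∀ y, Function.Bijective fun x => ost x y
  switch_bij : Function.Bijective fun p : X × X => (ost p.2 p.1, ust p.1 p.2)
  under_under : ∀ x y z, ust (ust x y) (ust z y) = ust (ust x z) (ost y z)
  over_over : ∀ x y z, ost (ost x y) (ost z y) = ost (ost x z) (ust y z)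
  under_over : ∀ x y z, ost (ust x y) (ust z y) = ust (ost x z) (ost y z)

section Biquandle

open Biquandle

variable {X : Type u} [Biquandle X]

/-- The inverse `x` overline-star-inverse `y`. -/
noncomputable def overInv (x y : X) : X := (Equiv.ofBijective _ (over_bij y)).symm x

/-- The inverse `x` underline-star-inverse `y`. -/
noncomputable def underInv (x y : X) : X := (Equiv.ofBijective _ (under_bij y)).symm x

theorem over_overInv (x y : X) : ost (overInv x y) y = x :=
  (Equiv.ofBijective _ (over_bij y)).apply_symm_apply x

theorem overInv_over (x y : X) : overInv (ost x y) y = x :=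
  (Equiv.ofBijective _ (over_bij y)).symm_apply_apply x

theorem under_underInv (x y : X) : ust (underInv x y) y = x :=
  (Equiv.ofBijective _ (under_bij y)).apply_symm_apply x

theorem underInv_under (x y : X) : underInv (ust x y) y = x :=
  (Equiv.ofBijective _ (under_bij y)).symm_apply_apply x

theorem over_cancel {x x' : X} (y : X) (h : ost x y = ost x' y) : x = x' :=
  (over_bij y).1 h

theorem under_cancel {x x' : X} (y : X) (h : ust x y = ust x' y) : x = x' :=
  (under_bij y).1 h

theorem diag_bij : Function.Bijective fun x : X => ost x x := by
  have inj : ∀ x x' : X, ost x x = ost x' x' → x = x' := by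
    intro x x' h
    have := (switch_bij (X := X)).1 (a₁ := (x, x)) (a₂ := (x', x'))
      (by simp [under_self, h])
    exact congrArg Prod.fst this
  refine ⟨fun x x' h => inj x x' h, fun y => ?_⟩
  obtain ⟨⟨s, t⟩, h⟩ := (switch_bij (X := X)).2 (y, y)
  simp only [Prod.mk.injEq] at h
  obtain ⟨h1, h2⟩ := h
  have e1 := under_under s t s
  rw [h1, h2] at e1
  have e1' := under_cancel _ e1
  refine ⟨s, ?_⟩
  show ost s s = y
  rw [← under_self, ← e1']

/-- The bijection `k : X → X` with `ost (k x) (k x) = x`. -/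
noncomputable def kMap : X ≃ X := (Equiv.ofBijective _ (diag_bij (X := X))).symm

theorem over_kMap (x : X) : ost (kMap x) (kMap x) = x :=
  (Equiv.ofBijective _ (diag_bij (X := X))).apply_symm_apply x

theorem kMap_over (x : X) : kMap (ost x x) = x :=
  (Equiv.ofBijective _ (diag_bij (X := X))).symm_apply_apply x

/-- The derived operation `x * y = (x underline-star y) overline-star-inverse y`. -/
noncomputable def qop (x y : X) : X := overInv (ust x y) y

theorem over_qop (x y : X) : ost (qop x y) y = ust x y := over_overInv _ _

theorem over_qop_distrib (a b c : X) :
    ost (qop a b) c = qop (ost a c) (ost b c) := by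
  apply over_cancel (ost b c)
  rw [over_qop, over_over, over_qop, under_over]

theorem under_qop_distrib (a b c : X) :
    ust (qop a b) c = qop (ust a c) (ust b c) := by
  apply over_cancel (ust b c)
  rw [over_qop, under_over, over_qop, under_under]

theorem overInv_qop_distrib (a b c : X) :
    overInv (qop a b) c = qop (overInv a c) (overInv b c) := by
  apply over_cancel c
  rw [over_overInv, over_qop_distrib, over_overInv, over_overInv]

theorem qop_self (x : X) : qop x x = x := by
  rw [qop, under_self, overInv_over]

theorem qop_distrib (a b c : X) : qop (qop a b) c = qop (qop a c) (qop b c) := by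
  conv_lhs => rw [qop, under_qop_distrib, overInv_qop_distrib]
  rfl

end Biquandle

/-- The underlying set of `Q(X)`. -/
def Qdl (X : Type u) : Type u := X

/-- The identity map `Q(X) → X` of underlying sets. -/
def Qdl.out {X : Type u} (a : Qdl X) : X := a

/-- The quandle `Q(X)`.  Mathlib writes quandles with a left action; a right-handed
quandle operation `a * b` is Mathlib's `b ◃ a`. -/
noncomputable instance (X : Type u) [Biquandle X] : Quandle (Qdl X) where
  act b a := qop (X := X) a b
  invAct b a := underInv (X := X) (Biquandle.ost (X := X) a b) b
  self_distrib {c b a} := qop_distrib (X := X) a b c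
  left_inv b a := (congrArg (fun t : X => underInv t b) (over_qop (X := X) a b)).trans
    (underInv_under (X := X) a b)
  right_inv b a := (congrArg (fun t : X => overInv t b)
    (under_underInv (X := X) (Biquandle.ost (X := X) a b) b)).trans (overInv_over (X := X) a b)
  fix {x} := qop_self (X := X) x

open Quandles in
/-- A quandle regarded as a biquandle with trivial over-operation. -/
abbrev Biquandle.ofQuandle (Q : Type u) [Quandle Q] : Biquandle Q where
  ust a b := b ◃ a
  ost a _ := a
  under_self x := Quandle.fix
  under_bij y := (Rack.act' y).bijective
  over_bij _ := Function.bijective_id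
  switch_bij := by
    constructor
    · rintro ⟨x, y⟩ ⟨x', y'⟩ h
      simp only [Prod.mk.injEq] at h
      obtain ⟨rfl, h⟩ := h
      rw [(Rack.act' y).injective h]
    · rintro ⟨y, z⟩
      exact ⟨(y ◃⁻¹ z, y), by simp⟩
  under_under _ _ _ := Shelf.self_distrib.symm
  over_over _ _ _ := rfl
  under_over _ _ _ := rfl

noncomputable instance (X : Type u) [Biquandle X] : Biquandle (Qdl X) :=
  Biquandle.ofQuandle (Qdl X)

/-! ### The associated group -/

/-- The relations `x · (y overline-star x) = y · (x underline-star y)`. -/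
def asRels (X : Type u) [Biquandle X] : Set (FreeGroup X) :=
  {r | ∃ x y : X, r =
    (FreeGroup.of x * FreeGroup.of (Biquandle.ost y x)) *
      (FreeGroup.of y * FreeGroup.of (Biquandle.ust x y))⁻¹}

/-- The associated group `As(X)`. -/
abbrev As (X : Type u) [Biquandle X] : Type u := PresentedGroup (asRels X)

/-- An element of `X` regarded as an element of `As(X)`. -/
def As.of {X : Type u} [Biquandle X] (x : X) : As X := PresentedGroup.of x

theorem As.rel {X : Type u} [Biquandle X] (x y : X) :
    As.of x * As.of (Biquandle.ost y x) = As.of y * As.of (Biquandle.ust x y) := by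
  have h : PresentedGroup.mk (asRels X)
      ((FreeGroup.of x * FreeGroup.of (Biquandle.ost y x)) *
      (FreeGroup.of y * FreeGroup.of (Biquandle.ust x y))⁻¹) = 1 :=
    (PresentedGroup.one_of_mem ⟨x, y, rfl⟩)
  rw [map_mul, map_inv, mul_inv_eq_one] at h
  exact h

/-! ### The maps `ψ`, `ψ_As` and `ψ̃`

The recursive clauses for `ψ(p · b^{±1}, -)` and `ψ_As(p · b^{±1})` only involve `b`,
`ψ(p, -)` and `ψ_As(p)`: they describe a permutation, depending on `b`, of the set of pairs
`(ψ_As(p), ψ(p, -))`.  The recursion is solved by letting `As(Q(X))` act, from the right,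
on pairs `(g, f)` with `g ∈ As(X)` and `f` a quandle homomorphism from `Q(X)` to itself. -/

section Psi

open Quandles

variable {X : Type u} [Biquandle X]

/-- Pairs `(g, f)` on which `As(Q(X))` acts. -/
abbrev PsiState (X : Type u) [Biquandle X] : Type u :=
  As X × {f : Qdl X → X // ∀ a b : Qdl X, f (b ◃ a) = qop (f a) (f b)}

/-- The action of a generator `b` on pairs: `(g, f)` goes to the pair of `g · f(b)` and
`a ↦ f(a) overline-star f(b)`. -/
noncomputable def psiStep (b : Qdl X) : Equiv.Perm (PsiState X) where
  toFun s := (s.1 * As.of (s.2.1 b),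
    ⟨fun a => Biquandle.ost (s.2.1 a) (s.2.1 b), fun x y => by
      beta_reduce
      rw [s.2.2, over_qop_distrib]⟩)
  invFun s := (s.1 * (As.of (overInv (s.2.1 b) (kMap (s.2.1 b))))⁻¹,
    ⟨fun a => overInv (s.2.1 a) (kMap (s.2.1 b)), fun x y => by
      beta_reduce
      rw [s.2.2, overInv_qop_distrib]⟩)
  left_inv := by
    rintro ⟨g, f, hf⟩
    refine Prod.ext ?_ (Subtype.ext ?_)
    · simp [kMap_over, overInv_over]
    · funext a
      simp [kMap_over, overInv_over]
  right_inv := by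
    rintro ⟨g, f, hf⟩
    have key : overInv (f b) (kMap (f b)) = kMap (f b) := by
      apply over_cancel (kMap (f b))
      rw [over_overInv, over_kMap]
    refine Prod.ext ?_ (Subtype.ext ?_)
    · simp
    · funext a
      simp [key, over_overInv]

theorem psiStep_rel (x y : Qdl X) (s : PsiState X) :
    psiStep y (psiStep x s) = psiStep (Biquandle.ust x y) (psiStep y s) := by
  obtain ⟨g, f, hf⟩ := s
  have h1 : Biquandle.ost (f (Biquandle.ust x y)) (f y) = Biquandle.ust (f x) (f y) := by
    rw [show f (Biquandle.ust x y) = qop (f x) (f y) from hf x y, over_qop]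
  refine Prod.ext ?_ (Subtype.ext ?_)
  · show g * As.of (f x) * As.of (Biquandle.ost (f y) (f x))
      = g * As.of (f y) * As.of (Biquandle.ost (f (Biquandle.ust x y)) (f y))
    rw [h1, mul_assoc, mul_assoc, As.rel]
  · funext a
    show Biquandle.ost (Biquandle.ost (f a) (f x)) (Biquandle.ost (f y) (f x))
      = Biquandle.ost (Biquandle.ost (f a) (f y)) (Biquandle.ost (f (Biquandle.ust x y)) (f y))
    rw [h1, Biquandle.over_over]

/-- The right action of `As(Q(X))` on pairs. -/
noncomputable def psiAct (X : Type u) [Biquandle X] :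
    As (Qdl X) →* (Equiv.Perm (PsiState X))ᵐᵒᵖ :=
  PresentedGroup.toGroup (f := fun b : Qdl X => MulOpposite.op (psiStep b)) (by
    rintro r ⟨x, y, rfl⟩
    simp only [map_mul, map_inv, FreeGroup.lift_apply_of]
    rw [mul_inv_eq_one]
    apply MulOpposite.unop_injective
    ext1 s
    exact psiStep_rel x y s)

/-- The pair `(ψ_As(p), ψ(p, -))`. -/
noncomputable def psiPair (p : As (Qdl X)) : PsiState X :=
  (psiAct X p).unop (1, ⟨Qdl.out, fun _ _ => rfl⟩)

/-- The map `ψ : As(Q(X)) × Q(X) → X`. -/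
noncomputable def psi (p : As (Qdl X)) (a : Qdl X) : X := (psiPair p).2.1 a

/-- The map `ψ_As : As(Q(X)) → As(X)`. -/
noncomputable def psiAs (p : As (Qdl X)) : As X := (psiPair p).1

/-- The map `ψ̃ = (ψ_As, ψ) : As(Q(X)) × Q(X) → As(X) × X`. -/
noncomputable def psiTilde (s : As (Qdl X) × Qdl X) : As X × X := (psiAs s.1, psi s.1 s.2)

theorem psiPair_mul_of (p : As (Qdl X)) (b : Qdl X) :
    psiPair (p * As.of b) = psiStep b (psiPair p) := by
  simp [psiPair, psiAct, As.of]

theorem psiPair_mul_of_inv (p : As (Qdl X)) (b : Qdl X) :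
    psiPair (p * (As.of b)⁻¹) = (psiStep b).symm (psiPair p) := by
  rw [Equiv.eq_symm_apply, ← psiPair_mul_of, inv_mul_cancel_right]

/-! The recursive clauses that determine `ψ` and `ψ_As`. -/

theorem psi_one (a : Qdl X) : psi 1 a = a.out := by
  simp [psi, psiPair]

theorem psi_mul_of (p : As (Qdl X)) (b a : Qdl X) :
    psi (p * As.of b) a = Biquandle.ost (psi p a) (psi p b) := by
  rw [psi, psiPair_mul_of]; rfl

theorem psi_mul_of_inv (p : As (Qdl X)) (b a : Qdl X) :
    psi (p * (As.of b)⁻¹) a = overInv (psi p a) (kMap (psi p b)) := by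
  rw [psi, psiPair_mul_of_inv]; rfl

theorem psiAs_one : psiAs (1 : As (Qdl X)) = 1 := by
  simp [psiAs, psiPair]

theorem psiAs_mul_of (p : As (Qdl X)) (a : Qdl X) :
    psiAs (p * As.of a) = psiAs p * As.of (psi p a) := by
  rw [psiAs, psiPair_mul_of]; rfl

theorem psiAs_mul_of_inv (p : As (Qdl X)) (a : Qdl X) :
    psiAs (p * (As.of a)⁻¹) = psiAs p * (As.of (psi (p * (As.of a)⁻¹) a))⁻¹ := by
  rw [psiAs, psi, psiPair_mul_of_inv]; rfl

end Psi

/-! ### Oriented tangle and link diagrams, sliced into horizontal strips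

A diagram in general position with respect to the height is cut into horizontal strips, each of
which contains exactly one crossing, local maximum or local minimum.  A horizontal level between
two strips meets the diagram in finitely many points, read from left to right and recorded as a
word of orientations: `true` for a string directed downwards, `false` for upwards. -/

/-- One strip.  In each case `l` and `r` are the orientations of the vertical strings to the left
and to the right of the elementary part.

* `cross l r a b o`: strand `A`, of orientation `a`, runs from top left to bottom right and strand
  `B`, of orientation `b`, from top right to bottom left; `A` is the over-strand iff `o = true`.
* `birth l r a`: a local maximum; below it there are two new strings of orientations `a`, `!a`.
* `death l r a`: a local minimum; it ends two strings of orientations `a`, `!a`. -/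
inductive Piece where
  | cross (l r : List Bool) (a b o : Bool)
  | birth (l r : List Bool) (a : Bool)
  | death (l r : List Bool) (a : Bool)

namespace Piece

/-- Orientations of the strings on the upper side of the strip. -/
def top : Piece → List Bool
  | cross l r a b _ => l ++ a :: b :: r
  | birth l r _ => l ++ r
  | death l r a => l ++ a :: (!a) :: r

/-- Orientations of the strings on the lower side of the strip. -/
def bot : Piece → List Bool
  | cross l r a b _ => l ++ b :: a :: r
  | birth l r a => l ++ a :: (!a) :: r
  | death l r _ => l ++ r

/-- The `i`-th string on the upper side continues, without meeting a crossing, to the `k`-th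
string on the lower side. -/
def Through : Piece → ℕ → ℕ → Prop
  | cross l _ _ _ _, i, k => i = k ∧ i ≠ l.length ∧ i ≠ l.length + 1
  | birth l _ _, i, k => (i < l.length ∧ k = i) ∨ (l.length ≤ i ∧ k = i + 2)
  | death l _ _, i, k => (k < l.length ∧ i = k) ∨ (l.length ≤ k ∧ i = k + 2)

/-- The `i`-th and `k`-th strings on the lower side are joined by a local maximum. -/
def JoinedBelow : Piece → ℕ → ℕ → Prop
  | birth l _ _, i, k => i = l.length ∧ k = l.length + 1
  | _, _, _ => False

/-- The `i`-th and `k`-th strings on the upper side are joined by a local minimum. -/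
def JoinedAbove : Piece → ℕ → ℕ → Prop
  | death l _ _, i, k => i = l.length ∧ k = l.length + 1
  | _, _, _ => False

/-- The `i`-th gap on the upper side and the `k`-th gap on the lower side lie in the same
component of the complement of the diagram in the strip.  (The `i`-th gap of a level is the
interval that has exactly `i` strings to its left.) -/
def GapThrough : Piece → ℕ → ℕ → Prop
  | cross l _ _ _ _, i, k => i = k ∧ i ≠ l.length + 1
  | birth l _ _, i, k => (i ≤ l.length ∧ k = i) ∨ (l.length ≤ i ∧ k = i + 2)
  | death l _ _, i, k => (k ≤ l.length ∧ i = k) ∨ (l.length ≤ k ∧ i = k + 2)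

/-- The same strip with `x` more strings on the left and `y` more on the right. -/
def shift (x y : List Bool) : Piece → Piece
  | cross l r a b o => cross (x ++ l) (r ++ y) a b o
  | birth l r a => birth (x ++ l) (r ++ y) a
  | death l r a => death (x ++ l) (r ++ y) a

/-- The strip turned upside down by reflection in a horizontal line (`true` still means downwards, so
every string is reversed as well); a crossing followed by its `flip` is
the side with two crossings of a Reidemeister move of type II. -/
def flip : Piece → Piece
  | cross l r a b o => cross l r b a !o
  | birth l r a => death l r a
  | death l r a => birth l r a

theorem Through.getElem? {s : Piece} {i k : ℕ} (h : s.Through i k) :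
    s.top[i]? = s.bot[k]? := by
  cases s with
  | cross l r a b o =>
    obtain ⟨rfl, h1, h2⟩ := h
    rcases lt_or_ge i l.length with h3 | h3
    · simp [top, bot, List.getElem?_append, h3]
    · obtain ⟨m, rfl⟩ : ∃ m, i = l.length + (m + 2) := ⟨i - l.length - 2, by omega⟩
      simp [top, bot, List.getElem?_append]
  | birth l r a =>
    rcases h with ⟨h, rfl⟩ | ⟨h, rfl⟩
    · simp [top, bot, List.getElem?_append, h]
    · obtain ⟨m, rfl⟩ := Nat.exists_eq_add_of_le h
      rw [add_assoc]
      simp [top, bot, List.getElem?_append]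
  | death l r a =>
    rcases h with ⟨h, rfl⟩ | ⟨h, rfl⟩
    · simp [top, bot, List.getElem?_append, h]
    · obtain ⟨m, rfl⟩ := Nat.exists_eq_add_of_le h
      rw [add_assoc]
      simp [top, bot, List.getElem?_append]

theorem Through.gap {s : Piece} {i k : ℕ} (h : s.Through i k) :
    s.GapThrough i k ∧ s.GapThrough (i + 1) (k + 1) := by
  cases s <;> simp only [Through, GapThrough] at h ⊢ <;> omega

theorem top_shift (x y : List Bool) (p : Piece) : (p.shift x y).top = x ++ p.top ++ y := by
  cases p <;> simp [shift, top]

theorem bot_shift (x y : List Bool) (p : Piece) : (p.shift x y).bot = x ++ p.bot ++ y := by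
  cases p <;> simp [shift, bot]

theorem top_flip (p : Piece) : p.flip.top = p.bot := by cases p <;> rfl

theorem bot_flip (p : Piece) : p.flip.bot = p.top := by cases p <;> rfl

end Piece

/-- The strips `ps` can be stacked, from `u` at the top to `v` at the bottom. -/
def Runs : List Bool → List Piece → List Bool → Prop
  | u, [], v => u = v
  | u, p :: ps, v => p.top = u ∧ Runs p.bot ps v

theorem Runs.append {u v w : List Bool} {ps qs : List Piece} (h : Runs u ps v)
    (h' : Runs v qs w) : Runs u (ps ++ qs) w := by
  induction ps generalizing u with
  | nil => cases h; exact h'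
  | cons p ps ih => exact ⟨h.1, ih h.2⟩

theorem Runs.shift {u v : List Bool} {ps : List Piece} (x y : List Bool) (h : Runs u ps v) :
    Runs (x ++ u ++ y) (ps.map (Piece.shift x y)) (x ++ v ++ y) := by
  induction ps generalizing u with
  | nil => cases h; rfl
  | cons p ps ih =>
    refine ⟨by rw [Piece.top_shift, h.1], ?_⟩
    rw [Piece.bot_shift]
    exact ih h.2

theorem Runs.flip {u v : List Bool} {ps : List Piece} (h : Runs u ps v) :
    Runs v (ps.map Piece.flip).reverse u := by
  induction ps generalizing u with
  | nil => cases h; rfl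
  | cons p ps ih =>
    rw [List.map_cons, List.reverse_cons]
    exact (ih h.2).append ⟨Piece.top_flip p, (Piece.bot_flip p).trans h.1⟩

/-- Orientations of the strings at level `j`; the empty word beyond the last level. -/
def wordAt : List Bool → List Piece → ℕ → List Bool
  | u, _, 0 => u
  | _, [], _ + 1 => []
  | _, p :: ps, j + 1 => wordAt p.bot ps j

theorem wordAt_top {u v : List Bool} {ps : List Piece} (h : Runs u ps v) {j : ℕ} {p : Piece}
    (hp : ps[j]? = some p) : wordAt u ps j = p.top := by
  induction ps generalizing u j with
  | nil => simp at hp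
  | cons q ps ih =>
    cases j with
    | zero => simp at hp; subst hp; exact h.1.symm
    | succ j => exact ih h.2 (by simpa using hp)

theorem wordAt_bot {u v : List Bool} {ps : List Piece} (h : Runs u ps v) {j : ℕ} {p : Piece}
    (hp : ps[j]? = some p) : wordAt u ps (j + 1) = p.bot := by
  induction ps generalizing u j with
  | nil => simp at hp
  | cons q ps ih =>
    cases j with
    | zero => simp at hp; subst hp; cases ps <;> rfl
    | succ j => exact ih h.2 (by simpa using hp)

theorem wordAt_of_lt {u : List Bool} {ps : List Piece} {j : ℕ} (h : ps.length < j) :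
    wordAt u ps j = [] := by
  induction ps generalizing u j with
  | nil => cases j with
    | zero => simp at h
    | succ j => rfl
  | cons q ps ih => cases j with
    | zero => simp at h
    | succ j => exact ih (by simpa using h)

/-- An oriented tangle diagram with upper end points `u` and lower end points `v`. -/
structure Tangle (u v : List Bool) where
  pieces : List Piece
  runs : Runs u pieces v

/-- An oriented link diagram in the plane. -/
abbrev LinkDiagram := Tangle [] []

namespace Tangle

variable {u v : List Bool} (T : Tangle u v)

/-- Orientations of the strings of `T` at level `j`. -/
def word (j : ℕ) : List Bool := wordAt u T.pieces j

variable {T} in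
theorem word_top {j : ℕ} {p : Piece} (hp : T.pieces[j]? = some p) : T.word j = p.top :=
  wordAt_top T.runs hp

variable {T} in
theorem word_bot {j : ℕ} {p : Piece} (hp : T.pieces[j]? = some p) : T.word (j + 1) = p.bot :=
  wordAt_bot T.runs hp

/-- The intersection points of the diagram with the levels. -/
@[ext]
structure Point where
  lvl : ℕ
  pos : ℕ
  pos_lt : pos < (T.word lvl).length

variable {T} in
theorem Point.lvl_le (p : T.Point) : p.lvl ≤ T.pieces.length := by
  by_contra h
  have := p.pos_lt
  rw [word, wordAt_of_lt (not_le.1 h)] at this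
  simp at this

variable {T} in
/-- The orientation of the diagram at a point (`true` is downwards). -/
def Point.dir (p : T.Point) : Bool := (T.word p.lvl)[p.pos]'p.pos_lt

/-- Two points are joined inside one strip, without passing through a crossing. -/
def Adj (p q : T.Point) : Prop :=
  ∃ (j : ℕ) (s : Piece), T.pieces[j]? = some s ∧
    ((p.lvl = j ∧ q.lvl = j + 1 ∧ s.Through p.pos q.pos) ∨
     (p.lvl = j + 1 ∧ q.lvl = j + 1 ∧ s.JoinedBelow p.pos q.pos) ∨
     (p.lvl = j ∧ q.lvl = j ∧ s.JoinedAbove p.pos q.pos))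

/-- The set `SA(T)` of semi-arcs. -/
def SemiArc : Type := Quot T.Adj

variable {T} in
/-- The semi-arc through a point. -/
def Point.semiArc (p : T.Point) : T.SemiArc := Quot.mk _ p

/-- The crossings of `T`. -/
structure Crossing where
  lvl : ℕ
  l : List Bool
  r : List Bool
  a : Bool
  b : Bool
  o : Bool
  get_eq : T.pieces[lvl]? = some (Piece.cross l r a b o)

namespace Crossing

variable {T} (c : T.Crossing)

/-- The four ends of a crossing. -/
def topLeft : T.Point := ⟨c.lvl, c.l.length, by rw [word_top c.get_eq]; simp [Piece.top]⟩
def topRight : T.Point := ⟨c.lvl, c.l.length + 1, by rw [word_top c.get_eq]; simp [Piece.top]⟩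
def botLeft : T.Point := ⟨c.lvl + 1, c.l.length, by rw [word_bot c.get_eq]; simp [Piece.bot]⟩
def botRight : T.Point :=
  ⟨c.lvl + 1, c.l.length + 1, by rw [word_bot c.get_eq]; simp [Piece.bot]⟩

theorem topLeft_dir : c.topLeft.dir = c.a := by
  have h : (T.word (c.lvl))[c.l.length]? = some c.topLeft.dir := List.getElem?_eq_getElem c.topLeft.pos_lt
  rw [word_top c.get_eq] at h
  simp [Piece.top] at h
  exact h.symm

theorem topRight_dir : c.topRight.dir = c.b := by
  have h : (T.word (c.lvl))[c.l.length + 1]? = some c.topRight.dir := List.getElem?_eq_getElem c.topRight.pos_lt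
  rw [word_top c.get_eq] at h
  simp [Piece.top] at h
  exact h.symm

theorem botLeft_dir : c.botLeft.dir = c.b := by
  have h : (T.word (c.lvl + 1))[c.l.length]? = some c.botLeft.dir := List.getElem?_eq_getElem c.botLeft.pos_lt
  rw [word_bot c.get_eq] at h
  simp [Piece.bot] at h
  exact h.symm

theorem botRight_dir : c.botRight.dir = c.a := by
  have h : (T.word (c.lvl + 1))[c.l.length + 1]? = some c.botRight.dir := List.getElem?_eq_getElem c.botRight.pos_lt
  rw [word_bot c.get_eq] at h
  simp [Piece.bot] at h
  exact h.symm

/-! Normal vectors are the tangent vectors turned by `+90` degrees, so that the normal vector of a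
string directed downwards points to the right.  Each of the two strands at a crossing consists of
two semi-arcs; its *source* is the one on the side of the other strand from which the normal
vector of that other strand emanates, and its *target* is the one on the other side. -/

def srcA : T.SemiArc := if c.b then c.topLeft.semiArc else c.botRight.semiArc
def tgtA : T.SemiArc := if c.b then c.botRight.semiArc else c.topLeft.semiArc
def srcB : T.SemiArc := if c.a then c.botLeft.semiArc else c.topRight.semiArc
def tgtB : T.SemiArc := if c.a then c.topRight.semiArc else c.botLeft.semiArc

def underSrc : T.SemiArc := if c.o then c.srcB else c.srcA
def underTgt : T.SemiArc := if c.o then c.tgtB else c.tgtA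
def overSrc : T.SemiArc := if c.o then c.srcA else c.srcB
def overTgt : T.SemiArc := if c.o then c.tgtA else c.tgtB

end Crossing

/-- The set `A(T)` of arcs: over-arcs are not divided at crossings. -/
def Arc : Type :=
  Quot fun s t : T.SemiArc => ∃ c : T.Crossing, s = c.overSrc ∧ t = c.overTgt

variable {T} in
/-- The projection from semi-arcs to arcs. -/
def SemiArc.arc (s : T.SemiArc) : T.Arc := Quot.mk _ s

end Tangle

/-! ### Colorings -/

/-- The set `Col_X(T)` of biquandle colorings. -/
@[ext]
structure Coloring (X : Type u) [Biquandle X] {u v : List Bool} (T : Tangle u v) where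
  color : T.SemiArc → X
  under_eq : ∀ c : T.Crossing,
    Biquandle.ust (color c.underSrc) (color c.overSrc) = color c.underTgt
  over_eq : ∀ c : T.Crossing,
    Biquandle.ost (color c.overSrc) (color c.underSrc) = color c.overTgt

open Quandles in
/-- The set `Col_Q(T)` of quandle colorings. -/
@[ext]
structure QColoring (Q : Type u) [Quandle Q] {u v : List Bool} (T : Tangle u v) where
  color : T.Arc → Q
  act_eq : ∀ c : T.Crossing,
    color c.overSrc.arc ◃ color c.underSrc.arc = color c.underTgt.arc

/-- A quandle coloring by `Q(X)`, composed with the projection from semi-arcs to arcs, as a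
biquandle coloring by the biquandle `Q(X)`. -/
noncomputable def QColoring.toColoring {X : Type u} [Biquandle X] {u v : List Bool}
    {T : Tangle u v} (C : QColoring (Qdl X) T) : Coloring (Qdl X) T where
  color s := C.color s.arc
  under_eq := C.act_eq
  over_eq c := congrArg C.color (Quot.sound ⟨c, rfl, rfl⟩)

/-- The colors of the strings at level `j`, from left to right. -/
def Coloring.level {X : Type u} [Biquandle X] {u v : List Bool} {T : Tangle u v}
    (C : Coloring X T) (j : ℕ) : List X :=
  List.ofFn fun i : Fin (T.word j).length =>
    C.color (Tangle.Point.semiArc ⟨j, i.1, i.2⟩)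

/-! ### Regions, region colorings and shadow colorings -/

namespace Tangle

variable {u v : List Bool} (T : Tangle u v)

/-- The gaps between consecutive strings at the levels of the diagram; gap `pos` has exactly
`pos` strings to its left. -/
@[ext]
structure Gap where
  lvl : ℕ
  pos : ℕ
  lvl_le : lvl ≤ T.pieces.length
  pos_le : pos ≤ (T.word lvl).length

/-- Two gaps are joined inside one strip in the complement of the diagram. -/
def GapAdj (g h : T.Gap) : Prop :=
  ∃ (j : ℕ) (s : Piece), T.pieces[j]? = some s ∧
    g.lvl = j ∧ h.lvl = j + 1 ∧ s.GapThrough g.pos h.pos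

/-- The set `R(T)` of regions. -/
def Region : Type := Quot T.GapAdj

variable {T}

/-- The region containing a gap. -/
def Gap.region (g : T.Gap) : T.Region := Quot.mk _ g

/-- The unbounded region of a link diagram (for a tangle: the region of the upper left end). -/
def unbounded (T : Tangle u v) : T.Region :=
  Gap.region ⟨0, 0, Nat.zero_le _, Nat.zero_le _⟩

/-- The gaps on the left and on the right of a point. -/
def Point.leftGap (p : T.Point) : T.Gap := ⟨p.lvl, p.pos, p.lvl_le, p.pos_lt.le⟩
def Point.rightGap (p : T.Point) : T.Gap := ⟨p.lvl, p.pos + 1, p.lvl_le, p.pos_lt⟩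

/-- The gap from which the normal vector at a point emanates, and the one to which it points. -/
def Point.srcGap (p : T.Point) : T.Gap := if p.dir then p.leftGap else p.rightGap
def Point.tgtGap (p : T.Point) : T.Gap := if p.dir then p.rightGap else p.leftGap

theorem Point.getElem?_dir (p : T.Point) : (T.word p.lvl)[p.pos]? = some p.dir :=
  List.getElem?_eq_getElem p.pos_lt

theorem Gap.region_eq {g h : T.Gap} {j : ℕ} {s : Piece} (hs : T.pieces[j]? = some s)
    (hg : g.lvl = j) (hh : h.lvl = j + 1) (hgh : s.GapThrough g.pos h.pos) :
    g.region = h.region :=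
  Quot.sound ⟨j, s, hs, hg, hh, hgh⟩

theorem adj_regions {p q : T.Point} (h : T.Adj p q) :
    p.srcGap.region = q.srcGap.region ∧ p.tgtGap.region = q.tgtGap.region := by
  obtain ⟨j, s, hs, h⟩ := h
  have hj : j < T.pieces.length := (List.getElem?_eq_some_iff.1 hs).1
  have dp := p.getElem?_dir
  have dq := q.getElem?_dir
  rcases h with ⟨hp, hq, h⟩ | ⟨hp, hq, h⟩ | ⟨hp, hq, h⟩
  · rw [hp, word_top hs, h.getElem?] at dp
    rw [hq, word_bot hs, dp, Option.some.injEq] at dq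
    have e1 : p.leftGap.region = q.leftGap.region := Gap.region_eq hs hp hq h.gap.1
    have e2 : p.rightGap.region = q.rightGap.region := Gap.region_eq hs hp hq h.gap.2
    simp only [Point.srcGap, Point.tgtGap, dq]
    split <;> exact ⟨by assumption, by assumption⟩
  · cases s with
    | birth l r a =>
      obtain ⟨h1, h2⟩ := h
      rw [hp, word_bot hs, h1] at dp
      rw [hq, word_bot hs, h2] at dq
      simp [Piece.bot] at dp dq
      have dq' : q.dir = !a := by rw [dq, Bool.not_not]
      have e1 : p.rightGap = q.leftGap :=
        Gap.ext (hp.trans hq.symm) (by simp [Point.rightGap, Point.leftGap, h1, h2])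
      let g : T.Gap := ⟨j, l.length, hj.le, by rw [word_top hs]; simp [Piece.top]⟩
      have e2 : g.region = p.leftGap.region := Gap.region_eq hs rfl hp (Or.inl ⟨le_rfl, h1⟩)
      have e3 : g.region = q.rightGap.region :=
        Gap.region_eq hs rfl hq (Or.inr ⟨le_rfl, congrArg (· + 1) h2⟩)
      simp only [Point.srcGap, Point.tgtGap, ← dp, dq']
      cases a <;> simp [e1, ← e2, e3]
    | cross => exact h.elim
    | death => exact h.elim
  · cases s with
    | death l r a =>
      obtain ⟨h1, h2⟩ := h
      rw [hp, word_top hs, h1] at dp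
      rw [hq, word_top hs, h2] at dq
      simp [Piece.top] at dp dq
      have dq' : q.dir = !a := by rw [dq, Bool.not_not]
      have e1 : p.rightGap = q.leftGap :=
        Gap.ext (hp.trans hq.symm) (by simp [Point.rightGap, Point.leftGap, h1, h2])
      let g : T.Gap := ⟨j + 1, l.length, hj, by rw [word_bot hs]; simp [Piece.bot]⟩
      have e2 : p.leftGap.region = g.region := Gap.region_eq hs hp rfl (Or.inl ⟨le_rfl, h1⟩)
      have e3 : q.rightGap.region = g.region :=
        Gap.region_eq hs hq rfl (Or.inr ⟨le_rfl, congrArg (· + 1) h2⟩)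
      simp only [Point.srcGap, Point.tgtGap, ← dp, dq']
      cases a <;> simp [e1, e2, e3]
    | cross => exact h.elim
    | birth => exact h.elim

/-- The specified region of a semi-arc: its normal vector emanates from it. -/
def SemiArc.specified (s : T.SemiArc) : T.Region :=
  Quot.lift (fun p : T.Point => p.srcGap.region) (fun _ _ h => (adj_regions h).1) s

/-- The region to which the normal vector of a semi-arc points. -/
def SemiArc.opposite (s : T.SemiArc) : T.Region :=
  Quot.lift (fun p : T.Point => p.tgtGap.region) (fun _ _ h => (adj_regions h).2) s

end Tangle

section Shadow

variable {X : Type u} [Biquandle X] {u v : List Bool} {T : Tangle u v}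

/-- The contribution of the `i`-th string at level `j`: its color or the inverse, according to the
orientation of the string. -/
noncomputable def Coloring.sign (C : Coloring X T) (p : T.Point) : As X :=
  if p.dir then As.of (C.color p.semiArc) else (As.of (C.color p.semiArc))⁻¹

/-- The color of a gap: the product of the contributions of the strings to its left. -/
noncomputable def Coloring.gapColor (C : Coloring X T) (j : ℕ) : ℕ → As X
  | 0 => 1
  | i + 1 => C.gapColor j i *
      if h : i < (T.word j).length then C.sign ⟨j, i, h⟩ else 1

theorem Coloring.gapColor_succ (C : Coloring X T) (p : T.Point) :
    C.gapColor p.lvl (p.pos + 1) = C.gapColor p.lvl p.pos * C.sign p := by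
  show C.gapColor p.lvl p.pos * (if h : p.pos < (T.word p.lvl).length then
    C.sign ⟨p.lvl, p.pos, h⟩ else 1) = _
  rw [dif_pos p.pos_lt]

theorem Coloring.sign_through (C : Coloring X T) {p q : T.Point} {j : ℕ} {s : Piece}
    (hs : T.pieces[j]? = some s) (hp : p.lvl = j) (hq : q.lvl = j + 1)
    (h : s.Through p.pos q.pos) : C.sign p = C.sign q := by
  have e : p.semiArc = q.semiArc := Quot.sound ⟨j, s, hs, Or.inl ⟨hp, hq, h⟩⟩
  have dp := p.getElem?_dir
  have dq := q.getElem?_dir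
  rw [hp, Tangle.word_top hs, h.getElem?] at dp
  rw [hq, Tangle.word_bot hs, dp, Option.some.injEq] at dq
  rw [sign, sign, e, dq]

/-- Passing both strands of a crossing on its upper and on its lower side. -/
theorem Coloring.sign_crossing (C : Coloring X T) (c : T.Crossing) :
    C.sign c.topLeft * C.sign c.topRight = C.sign c.botLeft * C.sign c.botRight := by
  have h1 := C.under_eq c
  have h2 := C.over_eq c
  have rel : ∀ x y : X, As.of x * As.of (Biquandle.ost y x) =
    As.of y * As.of (Biquandle.ust x y) := As.rel
  have r := rel (C.color c.underSrc) (C.color c.overSrc)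
  rw [h1, h2] at r
  rw [sign, sign, sign, sign, c.topLeft_dir, c.topRight_dir, c.botLeft_dir, c.botRight_dir]
  simp only [Tangle.Crossing.underSrc, Tangle.Crossing.underTgt, Tangle.Crossing.overSrc,
    Tangle.Crossing.overTgt, Tangle.Crossing.srcA, Tangle.Crossing.tgtA,
    Tangle.Crossing.srcB, Tangle.Crossing.tgtB] at r
  rcases ha : c.a <;> rcases hb : c.b <;> rcases ho : c.o <;>
    simp only [ha, hb, ho, if_true, if_false, Bool.false_eq_true] at r ⊢
  all_goals
    first
    | exact r
    | exact r.symm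
    | (rw [← mul_inv_rev, ← mul_inv_rev, inv_inj]
       first | exact r | exact r.symm)
    | (rw [inv_mul_eq_iff_eq_mul, ← mul_assoc, eq_mul_inv_iff_mul_eq]
       first | exact r | exact r.symm)
    | (rw [mul_inv_eq_iff_eq_mul, mul_assoc, eq_inv_mul_iff_mul_eq]
       first | exact r | exact r.symm)

theorem Coloring.gapColor_add_one (C : Coloring X T) {j i : ℕ} (h : i < (T.word j).length) :
    C.gapColor j (i + 1) = C.gapColor j i * C.sign ⟨j, i, h⟩ :=
  C.gapColor_succ ⟨j, i, h⟩

theorem Coloring.gapColor_step (C : Coloring X T) {j i k : ℕ} {s : Piece}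
    (hs : T.pieces[j]? = some s) (hi : i < (T.word j).length) (hk : k < (T.word (j + 1)).length)
    (h : s.Through i k) (e : C.gapColor j i = C.gapColor (j + 1) k) :
    C.gapColor j (i + 1) = C.gapColor (j + 1) (k + 1) := by
  rw [C.gapColor_add_one hi, C.gapColor_add_one hk, e]
  congr 1
  exact C.sign_through hs rfl rfl h

theorem Coloring.gapColor_turn (C : Coloring X T) {j i : ℕ} {a : Bool}
    (h0 : (T.word j)[i]? = some a) (h1 : (T.word j)[i + 1]? = some (!a))
    (h : ∀ p q : T.Point, p.lvl = j → p.pos = i → q.lvl = j → q.pos = i + 1 →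
      T.Adj p q) : C.gapColor j (i + 2) = C.gapColor j i := by
  obtain ⟨hi, h0⟩ := List.getElem?_eq_some_iff.1 h0
  obtain ⟨hi', h1⟩ := List.getElem?_eq_some_iff.1 h1
  have e : Tangle.Point.semiArc (⟨j, i, hi⟩ : T.Point) =
      Tangle.Point.semiArc (⟨j, i + 1, hi'⟩ : T.Point) := Quot.sound (h _ _ rfl rfl rfl rfl)
  rw [C.gapColor_add_one hi', C.gapColor_add_one hi, sign, sign, e, mul_assoc]
  have d0 : Tangle.Point.dir (⟨j, i, hi⟩ : T.Point) = a := h0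
  have d1 : Tangle.Point.dir (⟨j, i + 1, hi'⟩ : T.Point) = !a := h1
  rw [d0, d1]
  cases a <;> simp

theorem Coloring.gapColor_adj (C : Coloring X T) {g h : T.Gap} (hgh : T.GapAdj g h) :
    C.gapColor g.lvl g.pos = C.gapColor h.lvl h.pos := by
  obtain ⟨j, s, hs, hg, hh, hgh⟩ := hgh
  obtain ⟨gl, i, hgl, hi⟩ := g
  obtain ⟨hl, k, hhl, hk⟩ := h
  dsimp only at hg hh hgh hi hk ⊢
  subst hg hh
  have wt := Tangle.word_top hs
  have wb := Tangle.word_bot hs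
  cases s with
  | cross l r a b o =>
    obtain ⟨rfl, hne⟩ := hgh
    have lt : (T.word gl).length = l.length + r.length + 2 := by
      rw [wt]; simp [Piece.top]; omega
    have lb : (T.word (gl + 1)).length = l.length + r.length + 2 := by
      rw [wb]; simp [Piece.bot]; omega
    induction i using Nat.strong_induction_on with
    | _ i ih =>
      rcases i with _ | i
      · rfl
      · rcases eq_or_ne i (l.length + 1) with rfl | h1
        · have e := ih l.length (by omega) (by omega) (by omega) (by omega)
          have c := C.sign_crossing ⟨gl, l, r, a, b, o, hs⟩
          rw [C.gapColor_add_one (by omega), C.gapColor_add_one (by omega),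
            C.gapColor_add_one (by omega), C.gapColor_add_one (by omega), e, mul_assoc,
            mul_assoc]
          exact congrArg _ c
        · exact C.gapColor_step hs (by omega) (by omega) ⟨rfl, by omega, h1⟩
            (ih i (by omega) (by omega) h1 (by omega))
  | birth l r a =>
    have lt : (T.word gl).length = l.length + r.length := by
      rw [wt]; simp [Piece.top]
    have lb : (T.word (gl + 1)).length = l.length + r.length + 2 := by
      rw [wb]; simp [Piece.bot]; omega
    have left : ∀ m ≤ l.length, C.gapColor gl m = C.gapColor (gl + 1) m := by
      intro m hm
      induction m with
      | zero => rfl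
      | succ m ih =>
        exact C.gapColor_step hs (by omega) (by omega) (Or.inl ⟨by omega, rfl⟩) (ih (by omega))
    have turn : C.gapColor (gl + 1) (l.length + 2) = C.gapColor (gl + 1) l.length := by
      refine C.gapColor_turn (a := a) (by rw [wb]; simp [Piece.bot])
        (by rw [wb]; simp [Piece.bot]) ?_
      intro p q h1 h2 h3 h4
      exact ⟨gl, _, hs, Or.inr (Or.inl ⟨h1, h3, h2, h4⟩)⟩
    have right : ∀ m, m ≤ r.length →
        C.gapColor gl (l.length + m) = C.gapColor (gl + 1) (l.length + m + 2) := by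
      intro m hm
      induction m with
      | zero => exact (left _ le_rfl).trans turn.symm
      | succ m ih =>
        exact C.gapColor_step (i := l.length + m) (k := l.length + m + 2) hs (by omega) (by omega)
          (Or.inr ⟨by omega, rfl⟩) (ih (by omega))
    rcases hgh with ⟨h1, rfl⟩ | ⟨h1, rfl⟩
    · exact left _ h1
    · obtain ⟨m, rfl⟩ := Nat.exists_eq_add_of_le h1
      exact right m (by omega)
  | death l r a =>
    have lt : (T.word gl).length = l.length + r.length + 2 := by
      rw [wt]; simp [Piece.top]; omega
    have lb : (T.word (gl + 1)).length = l.length + r.length := by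
      rw [wb]; simp [Piece.bot]
    have left : ∀ m ≤ l.length, C.gapColor gl m = C.gapColor (gl + 1) m := by
      intro m hm
      induction m with
      | zero => rfl
      | succ m ih =>
        exact C.gapColor_step hs (by omega) (by omega) (Or.inl ⟨by omega, rfl⟩) (ih (by omega))
    have turn : C.gapColor gl (l.length + 2) = C.gapColor gl l.length := by
      refine C.gapColor_turn (a := a) (by rw [wt]; simp [Piece.top])
        (by rw [wt]; simp [Piece.top]) ?_
      intro p q h1 h2 h3 h4
      exact ⟨gl, _, hs, Or.inr (Or.inr ⟨h1, h3, h2, h4⟩)⟩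
    have right : ∀ m, m ≤ r.length →
        C.gapColor gl (l.length + m + 2) = C.gapColor (gl + 1) (l.length + m) := by
      intro m hm
      induction m with
      | zero => exact turn.trans (left _ le_rfl)
      | succ m ih =>
        exact C.gapColor_step (i := l.length + m + 2) (k := l.length + m) hs (by omega) (by omega)
          (Or.inr ⟨by omega, rfl⟩) (ih (by omega))
    rcases hgh with ⟨h1, rfl⟩ | ⟨h1, rfl⟩
    · exact left _ h1
    · obtain ⟨m, rfl⟩ := Nat.exists_eq_add_of_le h1
      exact right m (by omega)

/-- The region coloring with respect to `C`. -/
noncomputable def Coloring.regionColor (C : Coloring X T) (R : T.Region) : As X :=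
  Quot.lift (fun g : T.Gap => C.gapColor g.lvl g.pos) (fun _ _ h => C.gapColor_adj h) R

/-- The two conditions that characterize the region coloring. -/
def Coloring.IsRegionColoring (C : Coloring X T) (ρ : T.Region → As X) : Prop :=
  ρ T.unbounded = 1 ∧
    ∀ s : T.SemiArc, ρ s.specified * As.of (C.color s) = ρ s.opposite

theorem Coloring.regionColor_isRegionColoring (C : Coloring X T) :
    C.IsRegionColoring C.regionColor := by
  refine ⟨rfl, ?_⟩
  rintro ⟨p⟩
  have h := C.gapColor_succ p
  show C.gapColor p.srcGap.lvl p.srcGap.pos * As.of (C.color p.semiArc)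
    = C.gapColor p.tgtGap.lvl p.tgtGap.pos
  rw [sign] at h
  cases hd : p.dir <;>
    simp only [hd, if_true, if_false, Bool.false_eq_true, Tangle.Point.srcGap,
      Tangle.Point.tgtGap, Tangle.Point.leftGap, Tangle.Point.rightGap] at h ⊢ <;>
    rw [h]
  simp

/-- The region coloring of a link diagram is the only map with the two properties. -/
theorem Coloring.IsRegionColoring.eq {D : LinkDiagram} {C : Coloring X D} {ρ : D.Region → As X}
    (h : C.IsRegionColoring ρ) : ρ = C.regionColor := by
  have h' := C.regionColor_isRegionColoring
  have left : ∀ j (hj : j ≤ D.pieces.length),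
      D.unbounded = Tangle.Gap.region ⟨j, 0, hj, Nat.zero_le _⟩ := by
    intro j
    induction j with
    | zero => intro _; rfl
    | succ j ih =>
      intro hj
      rw [ih (by omega)]
      refine Tangle.Gap.region_eq (List.getElem?_eq_getElem (i := j) (by omega)) rfl rfl ?_
      cases D.pieces[j] <;> simp [Piece.GapThrough]
  funext R
  obtain ⟨j, i, hj, hi⟩ := R
  induction i with
  | zero =>
    have e := left j hj
    exact (congrArg ρ e.symm).trans (h.1.trans (h'.1.symm.trans (congrArg _ e)))
  | succ i ih =>
    have e := ih (by omega)
    let p : D.Point := ⟨j, i, hi⟩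
    have e : ρ p.leftGap.region = C.regionColor p.leftGap.region := e
    show ρ p.rightGap.region = C.regionColor p.rightGap.region
    have h2 : ρ p.srcGap.region * _ = ρ p.tgtGap.region := h.2 p.semiArc
    have h3 : C.regionColor p.srcGap.region * _ = C.regionColor p.tgtGap.region :=
      h'.2 p.semiArc
    cases hd : p.dir <;>
      simp only [hd, if_true, if_false, Bool.false_eq_true, Tangle.Point.srcGap,
        Tangle.Point.tgtGap] at h2 h3
    · rw [e, ← h3] at h2
      exact mul_right_cancel h2
    · rw [← h2, ← h3, e]

/-- The shadow coloring with respect to `C`. -/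
noncomputable def Coloring.shadow (C : Coloring X T) (s : T.SemiArc) : As X × X :=
  (C.regionColor s.specified, C.color s)

end Shadow

/-! ### The doubled diagram and the pulling away map -/

/-- Orientations of the strings of the doubled diagram `W(D)` at a level where `D` has strings
`u`.  A string of `D` and its parallel copy in `-D^v`, which has the opposite orientation and is
shifted into the direction of the normal vector, form a pair of which the left string is directed
downwards and the right string upwards: the string of `D` is the left one of the pair iff it is
directed downwards. -/
def dbl (u : List Bool) : List Bool := u.flatMap fun _ => [true, false]

/-- The crossing information in `W(D)` at a crossing of two strings `A`, `B`, where `mainA`,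
`mainB` tell whether the string belongs to `D` (and not to `-D^v`), and `o` tells whether `A` is
the over-strand at the original crossing of `D`: it is kept for two strings of `D` and reversed for
two strings of `-D^v`, and strings of `D` are over those of `-D^v`. -/
def dblOver (o mainA mainB : Bool) : Bool :=
  if mainA = mainB then (if mainA then o else !o) else mainA

/-- The part of the doubled diagram originating from one strip. -/
def Piece.double : Piece → List Piece
  | .cross l r a b o =>
    [.cross (dbl l ++ [true]) (false :: dbl r) false true (dblOver o (!a) b),
     .cross (dbl l) (false :: false :: dbl r) true true (dblOver o a b),
     .cross (dbl l ++ [true, true]) (dbl r) false false (dblOver o (!a) (!b)),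
     .cross (dbl l ++ [true]) (false :: dbl r) true false (dblOver o a (!b))]
  | .birth l r _ =>
    [.birth (dbl l) (dbl r) true, .birth (dbl l ++ [true]) (false :: dbl r) false]
  | .death l r _ =>
    [.death (dbl l ++ [true]) (false :: dbl r) false, .death (dbl l) (dbl r) true]

theorem dbl_append (u v : List Bool) : dbl (u ++ v) = dbl u ++ dbl v := by
  simp [dbl]

theorem Piece.runs_double (s : Piece) : Runs (dbl s.top) s.double (dbl s.bot) := by
  cases s <;> simp [Piece.double, Runs, Piece.top, Piece.bot, dbl]

theorem Runs.double {u v : List Bool} {ps : List Piece} (h : Runs u ps v) :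
    Runs (dbl u) (ps.flatMap Piece.double) (dbl v) := by
  induction ps generalizing u with
  | nil => cases h; rfl
  | cons p ps ih =>
    obtain ⟨rfl, h⟩ := h
    rw [List.flatMap_cons]
    exact p.runs_double.append (ih h)

/-- The doubled diagram `W(D)`. -/
def LinkDiagram.doubled (D : LinkDiagram) : LinkDiagram :=
  ⟨D.pieces.flatMap Piece.double, D.runs.double⟩

/-- The level of `W(D)` that is the double of level `j` of `D`. -/
def LinkDiagram.doubledLevel (D : LinkDiagram) (j : ℕ) : ℕ :=
  ((D.pieces.take j).flatMap Piece.double).length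

/-- A string of orientation `d`, with strings `x` to its left, is moved to the right behind the
strings `w`. -/
def slideBehind (x : List Bool) (d : Bool) : List Bool → List Piece
  | [] => []
  | b :: w => .cross x w d b false :: slideBehind (x ++ [b]) d w

theorem runs_slideBehind (x : List Bool) (d : Bool) (w : List Bool) :
    Runs (x ++ d :: w) (slideBehind x d w) (x ++ w ++ [d]) := by
  induction w generalizing x with
  | nil => simp [slideBehind, Runs]
  | cons b w ih =>
    refine ⟨rfl, ?_⟩
    have := ih (x ++ [b])
    simpa [Piece.bot] using this

/-- Pulling away the strings of `-D^v` from a doubled trivial tangle: the leftmost string of `-D^v`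
is moved behind all the others to the right end, then the second one to the left of the first, and
so on. -/
def pullPieces : List Bool → List Piece
  | [] => []
  | d :: u =>
    (if d then slideBehind [true] false (dbl u) else slideBehind [] true (false :: dbl u)) ++
      (pullPieces u).map (Piece.shift [d] [!d])

/-- Orientations of the strings of `D ⊔ -D^h` at a level where `D` has strings `u`. -/
def mirrored (u : List Bool) : List Bool := u ++ (u.map not).reverse

theorem runs_pullPieces (u : List Bool) : Runs (dbl u) (pullPieces u) (mirrored u) := by
  induction u with
  | nil => rfl
  | cons d u ih =>
    have h := ih.shift [d] [!d]
    have e : [d] ++ mirrored u ++ [!d] = mirrored (d :: u) := by simp [mirrored]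
    rw [e] at h
    refine Runs.append ?_ h
    cases d
    · exact runs_slideBehind [] true (false :: dbl u)
    · exact runs_slideBehind [true] false (dbl u)

/-- The doubled trivial tangle with strings `u`, after the strings of `-D^v` have been pulled away
in the middle part of the strip by Reidemeister moves of type II: the pulling is followed by its
inverse.  The level in the middle is `(pullPieces u).length`. -/
def pulledStrip (u : List Bool) : Tangle (dbl u) (dbl u) :=
  ⟨pullPieces u ++ ((pullPieces u).map Piece.flip).reverse,
    (runs_pullPieces u).append (runs_pullPieces u).flip⟩

section PullAway

variable {X : Type u} [Biquandle X] {D : LinkDiagram}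

/-- `E` is the coloring of `W(D)` that corresponds to the quandle coloring `C` of `D`: away from
the crossings of `D`, both strings of a pair receive the color that `C` assigns to the string of
`D`. -/
def IsDoubling (C : QColoring (Qdl X) D) (E : Coloring X D.doubled) : Prop :=
  ∀ j ≤ D.pieces.length,
    E.level (D.doubledLevel j) = (C.toColoring.level j).flatMap fun a => [a.out, a.out]

/-- `C'` is read off from a coloring `E` of `W(D)` after pulling away `-D^v`: at each level of `D`,
the doubled trivial tangle is replaced by `pulledStrip`, the coloring being unchanged outside of
it, and in the middle of the new strip the strings on the left, which are those of `D`, have the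
colors prescribed by `C'`. -/
def IsPulledAway (E : Coloring X D.doubled) (C' : Coloring X D) : Prop :=
  ∀ j ≤ D.pieces.length, ∃ F : Coloring X (pulledStrip (D.word j)),
    F.level 0 = E.level (D.doubledLevel j) ∧
    F.level (pulledStrip (D.word j)).pieces.length = E.level (D.doubledLevel j) ∧
    (F.level (pullPieces (D.word j)).length).take (D.word j).length = C'.level j

/-- `Ψ` is the pulling away map from `Q(X)`-colorings to `X`-colorings of `D`: take the doubled
coloring of `W(D)`, pull away `-D^v`, and restrict the coloring to `D`. -/
def IsPullingAwayMap (Ψ : QColoring (Qdl X) D → Coloring X D) : Prop :=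
  ∀ C C', C' = Ψ C ↔ ∃ E : Coloring X D.doubled, IsDoubling C E ∧ IsPulledAway E C'

end PullAway

end KnotColor

/-! The map `psi p` depends on `p` only through `psiAs p`. By the third biquandle axiom, `As X` acts
on `X` from the right, a generator `x` acting by overline-star with `x`, and `psi p a` is the result
of letting `psiAs p` act on `a` (`psi_eq_overPerm`). The action respects `qop`, so it is by
automorphisms of the quandle `Q(X)`.

Given a `Q(X)`-coloring, apply `psi` with the color of the specified region to each semi-arc. The
four regions at a crossing differ by the colors of the strands between them
(`Tangle.Crossing.regions`). Passing the over-strand adds one overline operation, which turns `qop`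
into the underline operation, so the result is an `X`-coloring (`QColoring.psiColoring`). Reading a
level from left to right shows that its region colors are the images under `psiAs` of the old ones;
this is the shadow formula. Conversely, undoing the action of the region colors of an `X`-coloring
gives a `Q(X)`-coloring (`Coloring.unpsi`), and the two constructions are mutually inverse.

It remains to see that this bijection is the pulling away map. Colorings of a sliced tangle are the
same as compatible sequences of words of colors (`Coloring.exists_of_chain`,
`Coloring.chain_level`). A string moved behind a doubled string keeps its color, and both strings of
the pair change in the same way (`crossRel_slide_pair`), so what remains to be pulled is again a
doubled word. If the string of `D` is directed downwards and has color `z`, pulling its copy applies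
overline-star with `z` to everything on the right. If it is directed upwards, the copy first passes
behind its own partner, whereby both colors `a` become `k(a)` (`crossRel_slide_self`), and then
applies the inverse of overline-star with `k(a)`. These are the clauses of `psi` for right
multiplication by a generator and by its inverse, with the color of the gap as group element
(`QColoring.drop_level_psiColoring`). The doubled coloring exists by `exists_double_cross`, and only
its prescribed levels enter the outcome. -/

namespace KnotColor

/-! ### The action of the associated group and its relation to `psi`. -/

section Psi

open Quandles

variable {X : Type u} [Biquandle X]

/-- The right action of `As(X)` on `X` in which a generator `x` acts by `· overline-star x`. -/
noncomputable def overAct (X : Type u) [Biquandle X] : As X →* (Equiv.Perm X)ᵐᵒᵖ :=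
  PresentedGroup.toGroup
    (f := fun x : X => MulOpposite.op (Equiv.ofBijective _ (Biquandle.over_bij x))) (by
    rintro r ⟨x, y, rfl⟩
    simp only [map_mul, map_inv, FreeGroup.lift_apply_of]
    rw [mul_inv_eq_one]
    apply MulOpposite.unop_injective
    ext1 z
    -- In the opposite group the left factor of a product acts first, so the defining relation of
    -- `As X` becomes exactly this axiom.
    exact Biquandle.over_over z x y)

/-- The permutation of `X` given by an element of `As(X)`. -/
noncomputable def overPerm (g : As X) : Equiv.Perm X := (overAct X g).unop

theorem overPerm_one (a : X) : overPerm (1 : As X) a = a := by simp [overPerm]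

theorem overPerm_mul_of (g : As X) (x a : X) :
    overPerm (g * As.of x) a = Biquandle.ost (overPerm g a) x := by
  simp [overPerm, overAct, As.of]

theorem overPerm_mul_of_inv (g : As X) (x a : X) :
    overPerm (g * (As.of x)⁻¹) a = overInv (overPerm g a) x := by
  apply over_cancel x
  rw [← overPerm_mul_of, inv_mul_cancel_right, over_overInv]

theorem As.closure_range_of : Subgroup.closure (Set.range (As.of : X → As X)) = ⊤ :=
  PresentedGroup.closure_range_of _

/-- Induction by right multiplication, the form in which `psi` and `psiAs` are recursive. Inverses
of generators need their own case because the clauses for them are different. -/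
theorem As.induction_on {P : As X → Prop} (one : P 1) (mul_of : ∀ p x, P p → P (p * As.of x))
    (mul_of_inv : ∀ p x, P p → P (p * (As.of x)⁻¹)) (p : As X) : P p := by
  have hp : p ∈ Subgroup.closure (Set.range (As.of : X → As X)) := by
    rw [As.closure_range_of]; trivial
  induction hp using Subgroup.closure_induction_right with
  | one => exact one
  | mul_right x hx y hy h => obtain ⟨y, rfl⟩ := hy; exact mul_of _ _ h
  | mul_inv_cancel x hx y hy h => obtain ⟨y, rfl⟩ := hy; exact mul_of_inv _ _ h

theorem overPerm_qop (g : As X) (a b : X) :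
    overPerm g (qop a b) = qop (overPerm g a) (overPerm g b) := by
  induction g using As.induction_on with
  | one => simp only [overPerm_one]
  | mul_of g x ih => simp only [overPerm_mul_of, ih, over_qop_distrib]
  | mul_of_inv g x ih => simp only [overPerm_mul_of_inv, ih, overInv_qop_distrib]

theorem overInv_kMap_self (x : X) : overInv x (kMap x) = kMap x := by
  apply over_cancel (kMap x)
  rw [over_overInv, over_kMap]

theorem psi_mul_of_inv_self (p : As (Qdl X)) (a : Qdl X) :
    psi (p * (As.of a)⁻¹) a = kMap (psi p a) := by
  rw [psi_mul_of_inv, overInv_kMap_self]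

/-- Both sides obey the same recursion. For an inverse generator, `psiAs` gains the inverse of `psi
(p * (As.of a)⁻¹) a`, which is `kMap (psi p a)`, the very element by which `psi` divides. -/
theorem psi_eq_overPerm (p : As (Qdl X)) (a : Qdl X) : psi p a = overPerm (psiAs p) a.out := by
  induction p using As.induction_on generalizing a with
  | one => rw [psi_one, psiAs_one, overPerm_one]
  | mul_of p x ih => rw [psi_mul_of, psiAs_mul_of, overPerm_mul_of, ih a]
  | mul_of_inv p x ih =>
    rw [psiAs_mul_of_inv, psi_mul_of_inv_self, overPerm_mul_of_inv, psi_mul_of_inv, ih a]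

theorem psi_act (p : As (Qdl X)) (a b : Qdl X) :
    psi p (b ◃ a) = qop (psi p a) (psi p b) :=
  (psiPair p).2.2 a b

end Psi

/-! ### Regions at a crossing -/

section Regions

variable {u v : List Bool} {T : Tangle u v}

/-- The two source semi-arcs bound the corner from which both normal vectors point away. Each target
semi-arc lies beyond the other strand, so its specified region is reached from that corner by
crossing the source semi-arc of the other strand. -/
theorem Tangle.Crossing.regions (c : T.Crossing) :
    c.overSrc.specified = c.underSrc.specified ∧
    c.underTgt.specified = c.overSrc.opposite ∧ c.overTgt.specified = c.underSrc.opposite := by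
  have hj : c.lvl < T.pieces.length := (List.getElem?_eq_some_iff.1 c.get_eq).1
  have d1 := c.topLeft_dir
  have d2 := c.topRight_dir
  have d3 := c.botLeft_dir
  have d4 := c.botRight_dir
  have e1 : c.topLeft.leftGap.region = c.botLeft.leftGap.region :=
    Gap.region_eq c.get_eq rfl rfl ⟨rfl, by simp [Tangle.Crossing.topLeft, Point.leftGap]⟩
  have e2 : c.topRight.rightGap.region = c.botRight.rightGap.region :=
    Gap.region_eq c.get_eq rfl rfl ⟨rfl, by simp [Tangle.Crossing.topRight, Point.rightGap]⟩
  have e3 : c.topLeft.rightGap.region = c.topRight.leftGap.region := rfl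
  have e4 : c.botLeft.rightGap.region = c.botRight.leftGap.region := rfl
  have spec : ∀ p : T.Point, p.semiArc.specified = p.srcGap.region := fun _ => rfl
  have opp : ∀ p : T.Point, p.semiArc.opposite = p.tgtGap.region := fun _ => rfl
  simp only [Tangle.Crossing.underSrc, Tangle.Crossing.underTgt, Tangle.Crossing.overSrc,
    Tangle.Crossing.overTgt, Tangle.Crossing.srcA, Tangle.Crossing.tgtA,
    Tangle.Crossing.srcB, Tangle.Crossing.tgtB]
  rcases ha : c.a <;> rcases hb : c.b <;> rcases ho : c.o <;>
    simp only [ha, hb] at d1 d2 d3 d4 <;>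
    simp [spec, opp, Point.srcGap, Point.tgtGap, d1, d2, d3, d4, e1, e2, e3, e4]

end Regions

/-! ### The bijection between the sets of colorings -/

section Bijection

open Quandles

variable {X : Type u} [Biquandle X] {u v : List Bool} {T : Tangle u v}

theorem Coloring.regionColor_opposite {Y : Type u} [Biquandle Y] (C : Coloring Y T)
    (s : T.SemiArc) : C.regionColor s.opposite = C.regionColor s.specified * As.of (C.color s) :=
  (C.regionColor_isRegionColoring.2 s).symm

/-- The `X`-coloring obtained from a `Q(X)`-coloring by applying `ψ` to the shadow coloring. -/
noncomputable def QColoring.psiColoring (C : QColoring (Qdl X) T) : Coloring X T where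
  color s := psi (C.toColoring.regionColor s.specified) (C.toColoring.color s)
  under_eq c := by
    obtain ⟨h1, h2, -⟩ := c.regions
    have h : C.toColoring.color c.underTgt =
      C.toColoring.color c.overSrc ◃ C.toColoring.color c.underSrc := (C.act_eq c).symm
    -- The region of the target is multiplied by the over-color; the overline operation this
    -- contributes cancels the inverse one hidden in `qop`.
    rw [h2, C.toColoring.regionColor_opposite, h1, h, psi_mul_of, psi_act, over_qop]
  over_eq c := by
    obtain ⟨h1, -, h2⟩ := c.regions
    have h : C.toColoring.color c.overTgt = C.toColoring.color c.overSrc :=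
      (C.toColoring.over_eq c).symm
    rw [h2, C.toColoring.regionColor_opposite, h1, h, psi_mul_of]

theorem QColoring.psiColoring_color (C : QColoring (Qdl X) T) (s : T.SemiArc) :
    C.psiColoring.color s = psi (C.toColoring.regionColor s.specified) (C.toColoring.color s) :=
  rfl

/-- A `Q(X)`-coloring is mapped to a coloring whose region coloring is given by `ψ_As`. -/
theorem gapColor_eq_psiAs {C : Coloring (Qdl X) T} {C' : Coloring X T} {j : ℕ}
    (h : ∀ p : T.Point, p.lvl = j → psiAs (C.gapColor j p.pos) = C'.gapColor j p.pos →
      C'.color p.semiArc = psi (C.gapColor j p.pos * if p.dir then 1 else C.sign p)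
        (C.color p.semiArc)) :
    ∀ i ≤ (T.word j).length, psiAs (C.gapColor j i) = C'.gapColor j i := by
  intro i
  induction i with
  | zero => intro _; exact psiAs_one
  | succ i ih =>
    intro hi
    have ih := ih (by omega)
    -- The induction hypothesis is passed on to `h`: for `unpsi` the color of a string is only known
    -- to be correct once the gap on its left is.
    have h := h ⟨j, i, hi⟩ rfl ih
    rw [C.gapColor_add_one hi, C'.gapColor_add_one hi, ← ih]
    rw [Coloring.sign] at h ⊢
    rw [Coloring.sign]
    cases hd : Tangle.Point.dir (⟨j, i, hi⟩ : T.Point) <;>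
      simp only [hd, if_true, if_false, Bool.false_eq_true, mul_one] at h ⊢
    -- For an upward string the specified region is on the right; accordingly the inverse clause of
    -- `psiAs` evaluates `psi` after the multiplication.
    · rw [psiAs_mul_of_inv, h]
    · rw [psiAs_mul_of, h]

theorem Coloring.regionColor_specified {Y : Type u} [Biquandle Y] (C : Coloring Y T)
    (p : T.Point) : C.regionColor p.semiArc.specified =
      C.gapColor p.lvl p.pos * if p.dir then 1 else C.sign p := by
  show C.gapColor p.srcGap.lvl p.srcGap.pos = _
  have h := C.gapColor_succ p
  cases hd : p.dir <;>
    simp [hd, Tangle.Point.srcGap, Tangle.Point.leftGap, Tangle.Point.rightGap, h]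

theorem QColoring.regionColor_psiColoring (C : QColoring (Qdl X) T) (R : T.Region) :
    C.psiColoring.regionColor R = psiAs (C.toColoring.regionColor R) := by
  obtain ⟨g⟩ := R
  refine (gapColor_eq_psiAs (fun p hp _ => ?_) g.pos g.pos_le).symm
  rw [C.psiColoring_color, C.toColoring.regionColor_specified, hp]

theorem QColoring.shadow_psiColoring (C : QColoring (Qdl X) T) :
    C.psiColoring.shadow = psiTilde ∘ C.toColoring.shadow := by
  funext s
  exact Prod.ext (C.regionColor_psiColoring _) rfl

/-- The `Q(X)`-coloring obtained from an `X`-coloring by letting the colors of the specified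
regions act. -/
noncomputable def Coloring.unpsi (C : Coloring X T) : QColoring (Qdl X) T where
  color := Quot.lift
    (fun s => ((overPerm (C.regionColor s.specified)).symm (C.color s) : X)) (by
      rintro _ _ ⟨c, rfl, rfl⟩
      obtain ⟨h1, -, h2⟩ := c.regions
      refine ((Equiv.symm_apply_eq (overPerm (C.regionColor c.overTgt.specified))).2 ?_).symm
      -- Where an over-arc passes a crossing, its color and its region change by overline-star with
      -- the same under-color, so the value is constant along the arc.
      rw [h2, C.regionColor_opposite, h1, overPerm_mul_of,
        Equiv.apply_symm_apply, C.over_eq])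
  act_eq c := by
    obtain ⟨h1, h2, -⟩ := c.regions
    show qop ((overPerm (C.regionColor c.underSrc.specified)).symm (C.color c.underSrc))
      ((overPerm (C.regionColor c.overSrc.specified)).symm (C.color c.overSrc)) =
      (overPerm (C.regionColor c.underTgt.specified)).symm (C.color c.underTgt)
    rw [Equiv.eq_symm_apply, h2, C.regionColor_opposite, h1, overPerm_mul_of, overPerm_qop,
      Equiv.apply_symm_apply, Equiv.apply_symm_apply, over_qop, C.under_eq]

theorem Coloring.unpsi_color (C : Coloring X T) (s : T.SemiArc) :
    (C.unpsi.toColoring.color s).out = (overPerm (C.regionColor s.specified)).symm (C.color s) :=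
  rfl

/-- This is what makes `unpsi` a right inverse: the region colors that were undone are the ones that
`psiColoring` puts back. It has to be proved from left to right, since both kinds of region colors
are built up that way. -/
theorem Coloring.psiAs_gapColor_unpsi (C : Coloring X T) (j : ℕ) :
    ∀ i ≤ (T.word j).length, psiAs (C.unpsi.toColoring.gapColor j i) = C.gapColor j i := by
  refine gapColor_eq_psiAs fun p hp h => ?_
  subst hp
  have e := C.unpsi_color p.semiArc
  rw [C.regionColor_specified, Equiv.eq_symm_apply] at e
  rw [Coloring.sign] at e ⊢
  cases hd : p.dir <;> simp only [hd, if_true, if_false, Bool.false_eq_true, mul_one] at e ⊢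
  -- Upward string: only the left gap is known so far. With `c` the color of the string, `e` says
  -- that dividing the value at the left gap by `c` gives `c`, so that value is `ost c c`, and
  -- `kMap` sends it to `c`.
  · rw [psi_mul_of_inv_self, psi_eq_overPerm, h]
    rw [overPerm_mul_of_inv] at e
    have e' := congrArg (Biquandle.ost · (C.color p.semiArc)) e
    simp only [over_overInv] at e'
    rw [e', kMap_over]
  · rw [psi_eq_overPerm, h, e]

theorem Coloring.psiColoring_unpsi (C : Coloring X T) : C.unpsi.psiColoring = C := by
  ext s
  have h : psiAs (C.unpsi.toColoring.regionColor s.specified) = C.regionColor s.specified := by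
    obtain ⟨g⟩ := s.specified
    exact C.psiAs_gapColor_unpsi g.lvl g.pos g.pos_le
  rw [QColoring.psiColoring_color, psi_eq_overPerm, h, C.unpsi_color, Equiv.apply_symm_apply]

theorem QColoring.unpsi_psiColoring (C : QColoring (Qdl X) T) : C.psiColoring.unpsi = C := by
  ext α
  obtain ⟨s⟩ := α
  refine (Equiv.symm_apply_eq (overPerm (C.psiColoring.regionColor s.specified))).2 ?_
  rw [C.regionColor_psiColoring, C.psiColoring_color, psi_eq_overPerm]
  rfl

/-- The bijection from `Q(X)`-colorings to `X`-colorings given by `ψ`. -/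
noncomputable def psiColoringEquiv (X : Type u) [Biquandle X] (T : Tangle u v) :
    QColoring (Qdl X) T ≃ Coloring X T where
  toFun := QColoring.psiColoring
  invFun := Coloring.unpsi
  left_inv := QColoring.unpsi_psiColoring
  right_inv := Coloring.psiColoring_unpsi

end Bijection

/-! ### Colorings as sequences of words of colors -/

section Levels

variable {X : Type u} [Biquandle X]

/-- The coloring conditions at a crossing whose ends have colors `p` (top left), `q` (top right),
`p'` (bottom left) and `q'` (bottom right). -/
def CrossRel (a b o : Bool) (p q p' q' : X) : Prop :=
  if o then
    Biquandle.ust (if a then p' else q) (if b then p else q') = (if a then q else p') ∧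
    Biquandle.ost (if b then p else q') (if a then p' else q) = (if b then q' else p)
  else
    Biquandle.ust (if b then p else q') (if a then p' else q) = (if b then q' else p) ∧
    Biquandle.ost (if a then p' else q) (if b then p else q') = (if a then q else p')

/-- Reflection in a horizontal line combined with reversal of the strands carries normal vectors to
normal vectors, so sources, targets and coloring conditions are preserved. -/
theorem CrossRel.flip {a b o : Bool} {p q p' q' : X} (h : CrossRel a b o p q p' q') :
    CrossRel b a (!o) p' q' p q := by
  cases o <;> simpa [CrossRel] using h

/-- The words of colors on the upper and the lower side of a colored strip. -/
def Piece.Rel : Piece → List X → List X → Prop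
  | cross l r a b o, w, w' => ∃ x y p q p' q', x.length = l.length ∧ y.length = r.length ∧
      w = x ++ p :: q :: y ∧ w' = x ++ p' :: q' :: y ∧ CrossRel a b o p q p' q'
  | birth l r _, w, w' => ∃ x y p, x.length = l.length ∧ y.length = r.length ∧
      w = x ++ y ∧ w' = x ++ p :: p :: y
  | death l r _, w, w' => ∃ x y p, x.length = l.length ∧ y.length = r.length ∧
      w = x ++ p :: p :: y ∧ w' = x ++ y

theorem Piece.Rel.flip {s : Piece} {w w' : List X} (h : s.Rel w w') : s.flip.Rel w' w := by
  cases s with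
  | cross l r a b o =>
    obtain ⟨x, y, p, q, p', q', hx, hy, h1, h2, h⟩ := h
    exact ⟨x, y, p', q', p, q, hx, hy, h2, h1, h.flip⟩
  | birth l r a =>
    obtain ⟨x, y, p, hx, hy, h1, h2⟩ := h
    exact ⟨x, y, p, hx, hy, h2, h1⟩
  | death l r a =>
    obtain ⟨x, y, p, hx, hy, h1, h2⟩ := h
    exact ⟨x, y, p, hx, hy, h2, h1⟩

theorem Piece.Rel.length_top {s : Piece} {w w' : List X} (h : s.Rel w w') :
    w.length = s.top.length := by
  cases s with
  | cross l r a b o =>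
    obtain ⟨x, y, p, q, p', q', hx, hy, rfl, -, -⟩ := h
    simp [top, hx, hy]
  | birth l r a =>
    obtain ⟨x, y, p, hx, hy, rfl, -⟩ := h
    simp [top, hx, hy]
  | death l r a =>
    obtain ⟨x, y, p, hx, hy, rfl, -⟩ := h
    simp [top, hx, hy]

theorem Piece.Rel.length_bot {s : Piece} {w w' : List X} (h : s.Rel w w') :
    w'.length = s.bot.length := by
  rw [h.flip.length_top, Piece.top_flip]

theorem Piece.Rel.getElem?_through {s : Piece} {w w' : List X} (h : s.Rel w w') {i k : ℕ}
    (ht : s.Through i k) : w[i]? = w'[k]? := by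
  cases s with
  | cross l r a b o =>
    obtain ⟨x, y, p, q, p', q', hx, hy, rfl, rfl, -⟩ := h
    obtain ⟨rfl, h1, h2⟩ := ht
    rw [← hx] at h1 h2
    rcases lt_or_ge i x.length with h3 | h3
    · simp [List.getElem?_append, h3]
    · obtain ⟨m, rfl⟩ : ∃ m, i = x.length + (m + 2) := ⟨i - x.length - 2, by omega⟩
      simp [List.getElem?_append]
  | birth l r a =>
    obtain ⟨x, y, p, hx, hy, rfl, rfl⟩ := h
    simp only [Through, ← hx] at ht
    rcases ht with ⟨h, rfl⟩ | ⟨h, rfl⟩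
    · simp [List.getElem?_append, h]
    · obtain ⟨m, rfl⟩ := Nat.exists_eq_add_of_le h
      rw [add_assoc]
      simp [List.getElem?_append]
  | death l r a =>
    obtain ⟨x, y, p, hx, hy, rfl, rfl⟩ := h
    simp only [Through, ← hx] at ht
    rcases ht with ⟨h, rfl⟩ | ⟨h, rfl⟩
    · simp [List.getElem?_append, h]
    · obtain ⟨m, rfl⟩ := Nat.exists_eq_add_of_le h
      rw [add_assoc]
      simp [List.getElem?_append]

theorem Piece.Rel.getElem?_joinedBelow {s : Piece} {w w' : List X} (h : s.Rel w w') {i k : ℕ}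
    (ht : s.JoinedBelow i k) : w'[i]? = w'[k]? := by
  cases s with
  | birth l r a =>
    obtain ⟨x, y, p, hx, hy, rfl, rfl⟩ := h
    obtain ⟨rfl, rfl⟩ := ht
    rw [← hx]
    simp
  | cross => exact ht.elim
  | death => exact ht.elim

theorem Piece.Rel.getElem?_joinedAbove {s : Piece} {w w' : List X} (h : s.Rel w w') {i k : ℕ}
    (ht : s.JoinedAbove i k) : w[i]? = w[k]? := by
  cases s with
  | death l r a =>
    obtain ⟨x, y, p, hx, hy, rfl, rfl⟩ := h
    obtain ⟨rfl, rfl⟩ := ht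
    rw [← hx]
    simp
  | cross => exact ht.elim
  | birth => exact ht.elim

/-- The words `L 0, L 1, …` color the strips `ps`. -/
def Chain (ps : List Piece) (L : ℕ → List X) : Prop :=
  ∀ (j : ℕ) (s : Piece), ps[j]? = some s → s.Rel (L j) (L (j + 1))

theorem Chain.append {ps qs : List Piece} {L M : ℕ → List X} (hL : Chain ps L) (hM : Chain qs M)
    (h : L ps.length = M 0) : ∃ N : ℕ → List X, Chain (ps ++ qs) N ∧
      (∀ j ≤ ps.length, N j = L j) ∧ ∀ j, N (ps.length + j) = M j := by
  refine ⟨fun j => if j ≤ ps.length then L j else M (j - ps.length), ?_, ?_, ?_⟩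
  · intro j s hs
    rcases lt_or_ge j ps.length with h1 | h1
    · rw [List.getElem?_append_left h1] at hs
      simp only [h1.le, Nat.succ_le_of_lt h1, if_true]
      exact hL j s hs
    · rw [List.getElem?_append_right h1] at hs
      have e := hM _ s hs
      dsimp only
      rw [if_neg (show ¬j + 1 ≤ ps.length by omega), show j + 1 - ps.length = j - ps.length + 1 by omega]
      -- At the seam `j = ps.length` the value is still taken from `L`; it agrees with `M 0` by `h`.
      rcases h1.eq_or_lt with rfl | h2
      · simpa [h] using e
      · rwa [if_neg (show ¬j ≤ ps.length by omega)]
  · intro j hj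
    simp [hj]
  · intro j
    rcases j with _ | j
    · simpa using h
    · simp

/-- Replaces every strip by several while keeping the words at the original levels; it assembles the
coloring of `W(D)` from its parts over single strips. -/
theorem Chain.flatMap {ps : List Piece} (f : Piece → List Piece) {L : ℕ → List X}
    (h : ∀ j s, ps[j]? = some s → ∃ M : ℕ → List X, Chain (f s) M ∧ M 0 = L j ∧
      M (f s).length = L (j + 1)) :
    ∃ N : ℕ → List X, Chain (ps.flatMap f) N ∧
      ∀ j ≤ ps.length, N ((ps.take j).flatMap f).length = L j := by
  induction ps generalizing L with
  | nil => exact ⟨L, by simp [Chain], by simp⟩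
  | cons p ps ih =>
    obtain ⟨M, hM, h0, h1⟩ := h 0 p rfl
    obtain ⟨N, hN, hL⟩ := ih (L := fun j => L (j + 1)) fun j s hs => h (j + 1) s (by simpa using hs)
    obtain ⟨K, hK, h2, h3⟩ := hM.append hN (by rw [h1]; exact (hL 0 (Nat.zero_le _)).symm)
    refine ⟨K, hK, fun j hj => ?_⟩
    rcases j with _ | j
    · exact (h2 0 (Nat.zero_le _)).trans h0
    · rw [List.take_succ_cons, List.flatMap_cons, List.length_append, h3]
      exact hL j (by simpa using hj)

/-! ### Passing between colorings of a tangle and chains of words. -/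

variable {u v : List Bool} {T : Tangle u v}

theorem Tangle.word_zero (T : Tangle u v) : T.word 0 = u := by
  rw [Tangle.word]; cases T.pieces <;> rfl

/-- Each strip fixes the length of the word below it. The top word needs the separate assumption
`h0`, because a chain over no strips imposes nothing on it. -/
theorem Chain.length_eq {L : ℕ → List X} (hL : Chain T.pieces L) (h0 : (L 0).length = u.length)
    {j : ℕ} (hj : j ≤ T.pieces.length) : (L j).length = (T.word j).length := by
  rcases j with _ | j
  · rw [T.word_zero, h0]
  · have hs := List.getElem?_eq_getElem (l := T.pieces) (i := j) (by omega)
    rw [Tangle.word_bot hs]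
    exact (hL j _ hs).length_bot

theorem Coloring.length_level (C : Coloring X T) (j : ℕ) :
    (C.level j).length = (T.word j).length := by
  simp [level]

theorem Coloring.getElem_level (C : Coloring X T) {j i : ℕ} (hi : i < (C.level j).length) :
    (C.level j)[i] = C.color (Tangle.Point.semiArc ⟨j, i, by rwa [C.length_level] at hi⟩) := by
  simp [level]

theorem Coloring.getElem?_level (C : Coloring X T) (p : T.Point) :
    (C.level p.lvl)[p.pos]? = some (C.color p.semiArc) := by
  rw [List.getElem?_eq_getElem (by rw [C.length_level]; exact p.pos_lt), C.getElem_level]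

theorem Coloring.ext_level {C C' : Coloring X T}
    (h : ∀ j ≤ T.pieces.length, C.level j = C'.level j) : C = C' := by
  ext s
  obtain ⟨p⟩ := s
  have e := C.getElem?_level p
  rw [h _ p.lvl_le, C'.getElem?_level] at e
  exact (Option.some.inj e).symm

/-- Words of colors that color the strips of a tangle are the levels of a coloring. -/
theorem Coloring.exists_of_chain {L : ℕ → List X} (hL : Chain T.pieces L)
    (h0 : (L 0).length = u.length) :
    ∃ C : Coloring X T, ∀ j ≤ T.pieces.length, C.level j = L j := by
  have hl : ∀ p : T.Point, p.pos < (L p.lvl).length := fun p => by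
    rw [hL.length_eq h0 p.lvl_le]; exact p.pos_lt
  let f : T.Point → X := fun p => (L p.lvl)[p.pos]'(hl p)
  have hf : ∀ p : T.Point, (L p.lvl)[p.pos]? = some (f p) := fun p =>
    List.getElem?_eq_getElem (hl p)
  -- The relation of each strip preserves colors along strings and across local extrema, so the
  -- function on points descends to semi-arcs.
  have adj : ∀ p q : T.Point, T.Adj p q → f p = f q := by
    rintro p q ⟨j, s, hs, h⟩
    apply Option.some.inj
    rw [← hf, ← hf]
    rcases h with ⟨hp, hq, h⟩ | ⟨hp, hq, h⟩ | ⟨hp, hq, h⟩ <;> rw [hp, hq]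
    · exact (hL j s hs).getElem?_through h
    · exact (hL j s hs).getElem?_joinedBelow h
    · exact (hL j s hs).getElem?_joinedAbove h
  let F : T.SemiArc → X := Quot.lift f adj
  have cr : ∀ c : T.Crossing, CrossRel c.a c.b c.o (f c.topLeft) (f c.topRight)
      (f c.botLeft) (f c.botRight) := by
    intro c
    obtain ⟨x, y, p, q, p', q', hx, hy, h1, h2, h⟩ := hL _ _ c.get_eq
    have e1 := hf c.topLeft
    have e2 := hf c.topRight
    have e3 := hf c.botLeft
    have e4 := hf c.botRight
    simp only [Tangle.Crossing.topLeft, Tangle.Crossing.topRight, Tangle.Crossing.botLeft,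
      Tangle.Crossing.botRight, h1, h2, ← hx] at e1 e2 e3 e4 ⊢
    simp at e1 e2 e3 e4
    rwa [← e1, ← e2, ← e3, ← e4]
  refine ⟨⟨F, fun c => ?_, fun c => ?_⟩, fun j hj => ?_⟩
  · have h := cr c
    simp only [Tangle.Crossing.underSrc, Tangle.Crossing.underTgt, Tangle.Crossing.overSrc,
      Tangle.Crossing.srcA, Tangle.Crossing.tgtA, Tangle.Crossing.srcB, Tangle.Crossing.tgtB,
      CrossRel] at h ⊢
    cases ha : c.a <;> cases hb : c.b <;> cases ho : c.o <;>
      simp only [ha, hb, ho, if_true, if_false, Bool.false_eq_true] at h ⊢ <;> exact h.1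
  · have h := cr c
    simp only [Tangle.Crossing.underSrc, Tangle.Crossing.overTgt, Tangle.Crossing.overSrc,
      Tangle.Crossing.srcA, Tangle.Crossing.tgtA, Tangle.Crossing.srcB, Tangle.Crossing.tgtB,
      CrossRel] at h ⊢
    cases ha : c.a <;> cases hb : c.b <;> cases ho : c.o <;>
      simp only [ha, hb, ho, if_true, if_false, Bool.false_eq_true] at h ⊢ <;> exact h.2
  · refine List.ext_getElem ?_ fun i h1 h2 => ?_
    · rw [Coloring.length_level, hL.length_eq h0 hj]
    · rw [Coloring.getElem_level]; rfl

theorem Coloring.crossRel (C : Coloring X T) (c : T.Crossing) :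
    CrossRel c.a c.b c.o (C.color c.topLeft.semiArc) (C.color c.topRight.semiArc)
      (C.color c.botLeft.semiArc) (C.color c.botRight.semiArc) := by
  have h1 := C.under_eq c
  have h2 := C.over_eq c
  simp only [Tangle.Crossing.underSrc, Tangle.Crossing.underTgt, Tangle.Crossing.overSrc,
    Tangle.Crossing.overTgt, Tangle.Crossing.srcA, Tangle.Crossing.tgtA,
    Tangle.Crossing.srcB, Tangle.Crossing.tgtB] at h1 h2
  rw [CrossRel]
  cases ha : c.a <;> cases hb : c.b <;> cases ho : c.o <;>
    simp only [ha, hb, ho, if_true, if_false, Bool.false_eq_true] at h1 h2 ⊢ <;>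
    exact ⟨h1, h2⟩

theorem exists_append_cons_cons {α : Type*} {w : List α} {m n : ℕ}
    (h : w.length = m + n + 2) : ∃ x y p q, x.length = m ∧ y.length = n ∧
      w = x ++ p :: q :: y := by
  refine ⟨w.take m, w.drop (m + 2), w[m], w[m + 1], by simp; omega, by simp; omega, ?_⟩
  rw [← List.drop_eq_getElem_cons, ← List.drop_eq_getElem_cons, List.take_append_drop]

theorem eq_append_cons_cons {α : Type*} {w x y : List α} {p q : α}
    (h : w.length = x.length + y.length + 2) (hx : ∀ i < x.length, w[i]? = x[i]?)
    (hp : w[x.length]? = some p) (hq : w[x.length + 1]? = some q)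
    (hy : ∀ i < y.length, w[x.length + (i + 2)]? = y[i]?) : w = x ++ p :: q :: y := by
  refine List.ext_getElem? fun i => ?_
  rcases lt_or_ge i x.length with h1 | h1
  · rw [hx i h1, List.getElem?_append_left h1]
  · obtain ⟨m, rfl⟩ := Nat.exists_eq_add_of_le h1
    rw [List.getElem?_append_right h1, Nat.add_sub_cancel_left]
    rcases m with _ | _ | m
    · exact hp
    · exact hq
    · rcases lt_or_ge m y.length with h2 | h2
      · exact hy m h2
      · rw [List.getElem?_eq_none (by omega), List.getElem?_eq_none (by simp; omega)]

theorem exists_append_of_length {α : Type*} {w : List α} {m n : ℕ}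
    (h : w.length = m + n) : ∃ x y, x.length = m ∧ y.length = n ∧ w = x ++ y :=
  ⟨w.take m, w.drop m, by simp; omega, by simp; omega, (List.take_append_drop m w).symm⟩

theorem Coloring.chain_level (C : Coloring X T) : Chain T.pieces C.level := by
  intro j s hs
  have lt := C.length_level j
  have lb := C.length_level (j + 1)
  rw [Tangle.word_top hs] at lt
  rw [Tangle.word_bot hs] at lb
  have adj : ∀ (p q : T.Point), T.Adj p q →
      (C.level p.lvl)[p.pos]? = (C.level q.lvl)[q.pos]? := fun p q h => by
    rw [C.getElem?_level, C.getElem?_level,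
      show p.semiArc = q.semiArc from Quot.sound h]
  have thr : ∀ i k, i < s.top.length → k < s.bot.length → s.Through i k →
      (C.level j)[i]? = (C.level (j + 1))[k]? := fun i k hi hk h =>
    adj ⟨j, i, by rwa [Tangle.word_top hs]⟩ ⟨j + 1, k, by rwa [Tangle.word_bot hs]⟩
      ⟨j, s, hs, Or.inl ⟨rfl, rfl, h⟩⟩
  cases s with
  | cross l r a b o =>
    simp only [Piece.top, Piece.bot, List.length_append, List.length_cons] at lt lb thr
    have cr := C.crossRel ⟨j, l, r, a, b, o, hs⟩
    have e1 := C.getElem?_level (Tangle.Crossing.topLeft ⟨j, l, r, a, b, o, hs⟩)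
    have e2 := C.getElem?_level (Tangle.Crossing.topRight ⟨j, l, r, a, b, o, hs⟩)
    have e3 := C.getElem?_level (Tangle.Crossing.botLeft ⟨j, l, r, a, b, o, hs⟩)
    have e4 := C.getElem?_level (Tangle.Crossing.botRight ⟨j, l, r, a, b, o, hs⟩)
    generalize C.color (Tangle.Crossing.topLeft _).semiArc = p at *
    generalize C.color (Tangle.Crossing.topRight _).semiArc = q at *
    generalize C.color (Tangle.Crossing.botLeft _).semiArc = p' at *
    generalize C.color (Tangle.Crossing.botRight _).semiArc = q' at *
    simp only [Tangle.Crossing.topLeft, Tangle.Crossing.topRight, Tangle.Crossing.botLeft,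
      Tangle.Crossing.botRight] at e1 e2 e3 e4 cr
    obtain ⟨x, y, p0, q0, hx, hy, h⟩ :=
      exists_append_cons_cons (w := C.level j) (m := l.length) (n := r.length) (by omega)
    rw [h] at e1 e2
    simp [← hx] at e1 e2
    subst e1 e2
    refine ⟨x, y, p0, q0, p', q', hx, hy, h, ?_, cr⟩
    -- The word below is recovered letter by letter: the strings going through are on the same
    -- semi-arcs as above, and the two middle letters are the lower ends of the crossing.
    refine eq_append_cons_cons (by omega) (fun i hi => ?_) (by rwa [hx]) (by rwa [hx])
      (fun i hi => ?_)
    · rw [← thr i i (by omega) (by omega) ⟨rfl, by omega, by omega⟩, h,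
        List.getElem?_append_left hi]
    · rw [← thr _ _ (by omega) (by omega) ⟨rfl, by omega, by omega⟩, h,
        List.getElem?_append_right (by omega), Nat.add_sub_cancel_left]
      rfl
  | birth l r a =>
    simp only [Piece.top, Piece.bot, List.length_append, List.length_cons] at lt lb thr
    obtain ⟨x, y, hx, hy, h⟩ :=
      exists_append_of_length (w := C.level j) (m := l.length) (n := r.length) (by omega)
    have b1 : l.length < (T.word (j + 1)).length := by
      rw [Tangle.word_bot hs]; simp [Piece.bot]
    have b2 : l.length + 1 < (T.word (j + 1)).length := by
      rw [Tangle.word_bot hs]; simp [Piece.bot]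
    have e1 := C.getElem?_level ⟨j + 1, l.length, b1⟩
    have e2 := adj ⟨j + 1, l.length, b1⟩ ⟨j + 1, l.length + 1, b2⟩
      ⟨j, _, hs, Or.inr (Or.inl ⟨rfl, rfl, rfl, rfl⟩)⟩
    dsimp only at e1 e2
    generalize C.color _ = p at e1
    refine ⟨x, y, p, hx, hy, h, ?_⟩
    refine eq_append_cons_cons (by omega) (fun i hi => ?_) (by rw [hx]; exact e1)
      (by rw [hx, ← e2]; exact e1) (fun i hi => ?_)
    · rw [← thr i i (by omega) (by omega) (Or.inl ⟨by omega, rfl⟩), h,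
        List.getElem?_append_left hi]
    · rw [← add_assoc, ← thr (x.length + i) _ (by omega) (by omega) (Or.inr ⟨by omega, rfl⟩), h,
        List.getElem?_append_right (by omega), Nat.add_sub_cancel_left]
  | death l r a =>
    simp only [Piece.top, Piece.bot, List.length_append, List.length_cons] at lt lb thr
    obtain ⟨x, y, hx, hy, h⟩ := exists_append_of_length (w := C.level (j + 1))
      (m := l.length) (n := r.length) (by omega)
    have b1 : l.length < (T.word j).length := by
      rw [Tangle.word_top hs]; simp [Piece.top]
    have b2 : l.length + 1 < (T.word j).length := by
      rw [Tangle.word_top hs]; simp [Piece.top]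
    have e1 := C.getElem?_level ⟨j, l.length, b1⟩
    have e2 := adj ⟨j, l.length, b1⟩ ⟨j, l.length + 1, b2⟩
      ⟨j, _, hs, Or.inr (Or.inr ⟨rfl, rfl, rfl, rfl⟩)⟩
    dsimp only at e1 e2
    generalize C.color _ = p at e1
    refine ⟨x, y, p, hx, hy, ?_, h⟩
    refine eq_append_cons_cons (by omega) (fun i hi => ?_) (by rw [hx]; exact e1)
      (by rw [hx, ← e2]; exact e1) (fun i hi => ?_)
    · rw [thr i i (by omega) (by omega) (Or.inl ⟨by omega, rfl⟩), h,
        List.getElem?_append_left hi]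
    · rw [← add_assoc, thr _ (x.length + i) (by omega) (by omega) (Or.inr ⟨by omega, rfl⟩), h,
        List.getElem?_append_right (by omega), Nat.add_sub_cancel_left]

end Levels

/-! ### Pulling away -/

section Dup

variable {X : Type u}

/-- The word in which every color is doubled. -/
def dup (c : List X) : List X := c.flatMap fun a => [a, a]

theorem dup_cons (a : X) (c : List X) : dup (a :: c) = a :: a :: dup c := rfl

theorem dup_append (c c' : List X) : dup (c ++ c') = dup c ++ dup c' := by simp [dup]

theorem length_dup {u : List Bool} {c : List X} (h : c.length = u.length) :
    (dup c).length = (dbl u).length := by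
  simp [dup, dbl, h]

/-- The doubled word of a word of colors of `Q(X)`. -/
def dupOut (c : List (Qdl X)) : List X := dup (c.map Qdl.out)

theorem dupOut_eq (c : List (Qdl X)) : dupOut c = c.flatMap fun a => [a.out, a.out] := by
  rw [dupOut, dup, List.flatMap_map]

end Dup

section Pull

variable {X : Type u} [Biquandle X]

/-- The strips `ps` can be colored with the words `w` at the top and `w'` at the bottom. -/
def ColorRuns : List X → List Piece → List X → Prop
  | w, [], w' => w = w'
  | w, p :: ps, w' => ∃ m, p.Rel w m ∧ ColorRuns m ps w'

theorem ColorRuns.exists_chain {w w' : List X} {ps : List Piece} (h : ColorRuns w ps w') :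
    ∃ L, Chain ps L ∧ L 0 = w ∧ L ps.length = w' := by
  induction ps generalizing w with
  | nil => exact ⟨fun _ => w, by simp [Chain], rfl, h⟩
  | cons p ps ih =>
    obtain ⟨m, h1, h2⟩ := h
    obtain ⟨L, hL, h0, h3⟩ := ih h2
    refine ⟨fun j => Nat.casesOn j w L, ?_, rfl, h3⟩
    intro j s hs
    rcases j with _ | j
    · simp only [List.getElem?_cons_zero, Option.some.injEq] at hs
      subst hs
      show p.Rel w (L 0)
      rwa [h0]
    · exact hL j s (by simpa using hs)

theorem Chain.colorRuns {L : ℕ → List X} {ps qs : List Piece} (h : Chain (ps ++ qs) L) :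
    ColorRuns (L 0) ps (L ps.length) := by
  induction ps generalizing L with
  | nil => rfl
  | cons p ps ih =>
    exact ⟨L 1, h 0 p rfl, ih (L := fun j => L (j + 1)) fun j s hs => h (j + 1) s (by simpa using hs)⟩

theorem colorRuns_append {w w' : List X} {ps qs : List Piece} :
    ColorRuns w (ps ++ qs) w' ↔ ∃ m, ColorRuns w ps m ∧ ColorRuns m qs w' := by
  induction ps generalizing w with
  | nil => simp [ColorRuns]
  | cons p ps ih =>
    simp only [List.cons_append, ColorRuns, ih]
    grind

theorem ColorRuns.flip {w w' : List X} {ps : List Piece} (h : ColorRuns w ps w') :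
    ColorRuns w' (ps.map Piece.flip).reverse w := by
  induction ps generalizing w with
  | nil => exact Eq.symm h
  | cons p ps ih =>
    obtain ⟨m, h1, h2⟩ := h
    rw [List.map_cons, List.reverse_cons, colorRuns_append]
    exact ⟨m, ih h2, w, h1.flip, rfl⟩

theorem Piece.rel_shift {s : Piece} {x y : List Bool} {cx cy w W : List X}
    (hx : cx.length = x.length) (hy : cy.length = y.length) :
    (s.shift x y).Rel (cx ++ w ++ cy) W ↔ ∃ w', W = cx ++ w' ++ cy ∧ s.Rel w w' := by
  -- The active part `m` lies inside `w`: by length, the words on either side of it contain the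
  -- added words `cx` and `cy`.
  have split : ∀ {l r : List Bool} {z1 z2 m : List X}, z1.length = (x ++ l).length →
      z2.length = (r ++ y).length → cx ++ w ++ cy = z1 ++ m ++ z2 →
      ∃ z1' z2', z1'.length = l.length ∧ z2'.length = r.length ∧ z1 = cx ++ z1' ∧
        z2 = z2' ++ cy ∧ w = z1' ++ m ++ z2' := by
    intro l r z1 z2 m h1 h2 h
    rw [List.length_append] at h1 h2
    obtain ⟨a1, b1, ha1, hb1, rfl⟩ := exists_append_of_length h1
    obtain ⟨a2, b2, ha2, hb2, rfl⟩ := exists_append_of_length h2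
    simp only [List.append_assoc] at h
    obtain ⟨rfl, h'⟩ := List.append_inj h (by omega)
    rw [show b1 ++ (m ++ (a2 ++ b2)) = (b1 ++ m ++ a2) ++ b2 by simp] at h'
    obtain ⟨rfl, rfl⟩ := List.append_inj' h' (by omega)
    exact ⟨b1, a2, hb1, ha2, rfl, rfl, by simp⟩
  cases s with
  | cross l r a b o =>
    constructor
    · rintro ⟨z1, z2, p, q, p', q', h1, h2, h, rfl, c⟩
      obtain ⟨b1, a2, g1, g2, rfl, rfl, rfl⟩ := split (m := [p, q]) h1 h2 (by simpa using h)
      exact ⟨b1 ++ p' :: q' :: a2, by simp, b1, a2, p, q, p', q', g1, g2, by simp, rfl, c⟩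
    · rintro ⟨w', rfl, z1, z2, p, q, p', q', h1, h2, rfl, rfl, c⟩
      exact ⟨cx ++ z1, z2 ++ cy, p, q, p', q', by simp [hx, h1], by simp [hy, h2], by simp,
        by simp, c⟩
  | birth l r a =>
    constructor
    · rintro ⟨z1, z2, p, h1, h2, h, rfl⟩
      obtain ⟨b1, a2, g1, g2, rfl, rfl, rfl⟩ := split (m := []) h1 h2 (by simpa using h)
      exact ⟨b1 ++ p :: p :: a2, by simp, b1, a2, p, g1, g2, by simp, rfl⟩
    · rintro ⟨w', rfl, z1, z2, p, h1, h2, rfl, rfl⟩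
      exact ⟨cx ++ z1, z2 ++ cy, p, by simp [hx, h1], by simp [hy, h2], by simp, by simp⟩
  | death l r a =>
    constructor
    · rintro ⟨z1, z2, p, h1, h2, h, rfl⟩
      obtain ⟨b1, a2, g1, g2, rfl, rfl, rfl⟩ := split (m := [p, p]) h1 h2 (by simpa using h)
      exact ⟨b1 ++ a2, by simp, b1, a2, p, g1, g2, by simp, rfl⟩
    · rintro ⟨w', rfl, z1, z2, p, h1, h2, rfl, rfl⟩
      exact ⟨cx ++ z1, z2 ++ cy, p, by simp [hx, h1], by simp [hy, h2], by simp, by simp⟩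

theorem colorRuns_shift {ps : List Piece} {x y : List Bool} {cx cy w W : List X}
    (hx : cx.length = x.length) (hy : cy.length = y.length) :
    ColorRuns (cx ++ w ++ cy) (ps.map (Piece.shift x y)) W ↔
      ∃ w', W = cx ++ w' ++ cy ∧ ColorRuns w ps w' := by
  induction ps generalizing w with
  | nil => simp [ColorRuns, eq_comm]
  | cons p ps ih =>
    simp only [List.map_cons, ColorRuns, Piece.rel_shift hx hy]
    constructor
    · rintro ⟨_, ⟨m, rfl, h1⟩, h2⟩
      obtain ⟨w', rfl, h⟩ := ih.1 h2
      exact ⟨w', rfl, m, h1, h⟩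
    · rintro ⟨w', rfl, m, h1, h⟩
      exact ⟨_, ⟨m, rfl, h1⟩, ih.2 ⟨w', rfl, h⟩⟩

theorem Piece.rel_cross_iff {l r : List Bool} {a b o : Bool} {x y W : List X} {p q : X}
    (hx : x.length = l.length) (hy : y.length = r.length) :
    (Piece.cross l r a b o).Rel (x ++ p :: q :: y) W ↔
      ∃ p' q', W = x ++ p' :: q' :: y ∧ CrossRel a b o p q p' q' := by
  constructor
  · rintro ⟨x', y', p0, q0, p', q', hx', hy', h, rfl, c⟩
    obtain ⟨rfl, h1⟩ := List.append_inj h (hx.trans hx'.symm)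
    simp only [List.cons.injEq] at h1
    obtain ⟨rfl, rfl, rfl⟩ := h1
    exact ⟨p', q', rfl, c⟩
  · rintro ⟨p', q', rfl, c⟩
    exact ⟨x, y, p, q, p', q', hx, hy, rfl, rfl, c⟩

/-! ### The effect of moving one string behind the others. -/

/-- The new color of a doubled string behind which a string of orientation `d` and color `z` has
been moved to the right. -/
noncomputable def slid (d : Bool) (z x : X) : X :=
  if d then overInv x z else Biquandle.ost x z

/-- The pair is antiparallel with equal colors, so the second crossing undoes what the first did to
the moving string, as in a Reidemeister move of type II. The equivalence contains the uniqueness of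
the new colors. -/
theorem crossRel_slide_pair {d : Bool} {z x p1 z1 p2 z2 : X} :
    CrossRel d true false z x p1 z1 ∧ CrossRel d false false z1 x p2 z2 ↔
      (p1 = slid d z x ∧ z1 = Biquandle.ust z (if d then slid d z x else x)) ∧
        p2 = slid d z x ∧ z2 = z := by
  cases d
  · simp only [CrossRel, slid, if_false, Bool.false_eq_true, if_true]
    constructor
    · rintro ⟨⟨rfl, rfl⟩, h1, rfl⟩
      obtain rfl := under_cancel _ h1
      exact ⟨⟨rfl, rfl⟩, rfl, rfl⟩
    · rintro ⟨⟨rfl, rfl⟩, rfl, rfl⟩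
      exact ⟨⟨rfl, rfl⟩, rfl, rfl⟩
  · simp only [CrossRel, slid, if_false, Bool.false_eq_true, if_true]
    constructor
    · rintro ⟨⟨rfl, h0⟩, h1, h2⟩
      -- For this orientation the unknown colors are the sources at the second crossing; injectivity
      -- of the switch map identifies them with the sources at the first.
      have e := (Biquandle.switch_bij (X := X)).1 (a₁ := (z2, p2)) (a₂ := (z, p1))
        (Prod.ext (h2.trans h0.symm) h1)
      simp only [Prod.mk.injEq] at e
      obtain ⟨rfl, rfl⟩ := e
      rw [← h0, overInv_over]
      exact ⟨⟨rfl, rfl⟩, rfl, rfl⟩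
    · rintro ⟨⟨rfl, rfl⟩, rfl, rfl⟩
      exact ⟨⟨rfl, over_overInv _ _⟩, rfl, over_overInv _ _⟩

/-- The copy of an upward string starts on the left of its partner and has to cross it. Both lower
ends are sources here and both targets are `z`, so bijectivity of the switch map leaves only the
diagonal solution. -/
theorem crossRel_slide_self {z p z' : X} :
    CrossRel true false false z z p z' ↔ p = kMap z ∧ z' = kMap z := by
  simp only [CrossRel, if_false, Bool.false_eq_true, if_true]
  constructor
  · rintro ⟨h1, h2⟩
    have e := (Biquandle.switch_bij (X := X)).1 (a₁ := (z', p)) (a₂ := (kMap z, kMap z))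
      (Prod.ext (h2.trans (over_kMap z).symm)
        (h1.trans ((over_kMap z).symm.trans (Biquandle.under_self _).symm)))
    simp only [Prod.mk.injEq] at e
    exact e.symm
  · rintro ⟨rfl, rfl⟩
    exact ⟨(Biquandle.under_self _).trans (over_kMap z), over_kMap z⟩

/-- Moving a string behind doubled strings. -/
theorem colorRuns_slideBehind {x u : List Bool} {cx c W : List X} {d : Bool} {z : X}
    (hx : cx.length = x.length) (hc : c.length = u.length) :
    ColorRuns (cx ++ z :: dup c) (slideBehind x d (dbl u)) W ↔
      W = cx ++ dup (c.map (slid d z)) ++ [z] := by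
  induction u generalizing x cx c with
  | nil =>
    obtain rfl := List.length_eq_zero_iff.1 hc
    simp [slideBehind, dbl, dup, ColorRuns, eq_comm]
  | cons b u ih =>
    obtain ⟨a, c, rfl⟩ := List.exists_cons_of_length_eq_add_one hc
    have hc' : c.length = u.length := by simpa using hc
    have hl := length_dup hc'
    -- After one pair the moving string again has color `z`, so the induction continues with this
    -- pair added to the left.
    have ih' := ih (x := x ++ [true] ++ [false]) (cx := cx ++ [slid d z a, slid d z a])
      (by simp [hx]) hc'
    have e : dbl (b :: u) = true :: false :: dbl u := rfl
    rw [e, dup_cons, List.map_cons, dup_cons, slideBehind, slideBehind]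
    have key : cx ++ slid d z a :: slid d z a :: dup (c.map (slid d z)) ++ [z] =
      (cx ++ [slid d z a, slid d z a]) ++ dup (c.map (slid d z)) ++ [z] := by simp
    rw [key, ← ih']
    constructor
    · rintro ⟨m1, h1, m2, h2, h⟩
      obtain ⟨p1, z1, rfl, g1⟩ := (Piece.rel_cross_iff hx (by simp [hl])).1 h1
      rw [show cx ++ p1 :: z1 :: a :: dup c = (cx ++ [p1]) ++ z1 :: a :: dup c by simp,
        Piece.rel_cross_iff (by simp [hx]) hl] at h2
      obtain ⟨p2, z2, rfl, g2⟩ := h2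
      obtain ⟨⟨rfl, rfl⟩, rfl, rfl⟩ := crossRel_slide_pair.1 ⟨g1, g2⟩
      simpa using h
    · intro h
      obtain ⟨h1, h2⟩ := crossRel_slide_pair.2 (⟨⟨rfl, rfl⟩, rfl, rfl⟩ :
        (_ = slid d z a ∧ _ = Biquandle.ust z (if d then slid d z a else a)) ∧
          _ = slid d z a ∧ _ = z)
      refine ⟨_, (Piece.rel_cross_iff hx (by simp [hl])).2 ⟨_, _, rfl, h1⟩, _, ?_, h⟩
      rw [List.append_cons cx, Piece.rel_cross_iff (by simp [hx]) hl]
      exact ⟨_, _, by simp, h2⟩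

/-- The colors at the end of the pulling of a trivial tangle with strings `u` and doubled
colors `c`. -/
noncomputable def pullColors : List Bool → List X → List X
  | d :: u, a :: c =>
    let z := if d then a else kMap a
    z :: pullColors u (c.map (slid (!d) z)) ++ [z]
  | _, _ => []

/-- The first half of `pullColors`. -/
noncomputable def pullMain : List Bool → List X → List X
  | d :: u, a :: c =>
    let z := if d then a else kMap a
    z :: pullMain u (c.map (slid (!d) z))
  | _, _ => []

theorem take_pullColors {u : List Bool} {c : List X} (h : c.length = u.length) :
    (pullColors u c).take u.length = pullMain u c ∧ u.length ≤ (pullColors u c).length := by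
  induction u generalizing c with
  | nil => obtain rfl := List.length_eq_zero_iff.1 h; simp [pullColors, pullMain]
  | cons d u ih =>
    obtain ⟨a, c, rfl⟩ := List.exists_cons_of_length_eq_add_one h
    have h : c.length = u.length := by simpa using h
    obtain ⟨h1, h2⟩ := ih (c := c.map (slid (!d) (if d then a else kMap a))) (by simpa using h)
    simp only [pullColors, pullMain, List.length_cons, List.cons_append, List.take_succ_cons,
      List.length_append, List.cons.injEq, true_and]
    refine ⟨?_, by omega⟩
    rw [List.take_append_of_le_length h2, h1]

/-- Once the first copy has been moved away, the strings between the two ends form a doubled word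
again, so the induction applies to them. The equivalence says that the doubled word at the top
extends in exactly one way. -/
theorem colorRuns_pullPieces {u : List Bool} {c W : List X} (h : c.length = u.length) :
    ColorRuns (dup c) (pullPieces u) W ↔ W = pullColors u c := by
  induction u generalizing c W with
  | nil =>
    obtain rfl := List.length_eq_zero_iff.1 h
    simp [pullPieces, pullColors, dup, ColorRuns, eq_comm]
  | cons d u ih =>
    obtain ⟨a, c, rfl⟩ := List.exists_cons_of_length_eq_add_one h
    have h' : c.length = u.length := by simpa using h
    -- Only for `d = false` does the copy lie on the left of its partner and meet the additional
    -- crossing that introduces `kMap`.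
    have first : ∀ m, ColorRuns (dup (a :: c)) (if d then slideBehind [true] false (dbl u)
        else slideBehind [] true (false :: dbl u)) m ↔
        m = [if d then a else kMap a] ++ dup (c.map (slid (!d) (if d then a else kMap a))) ++
          [if d then a else kMap a] := by
      intro m
      cases d
      · simp only [if_false, Bool.false_eq_true, slideBehind, ColorRuns, dup_cons, Bool.not_false]
        constructor
        · rintro ⟨_, h1, h2⟩
          obtain ⟨p, z, rfl, g1⟩ := (Piece.rel_cross_iff (X := X) (x := []) rfl (length_dup h')).1 h1
          obtain ⟨rfl, rfl⟩ := crossRel_slide_self.1 g1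
          exact (colorRuns_slideBehind (X := X) (cx := [kMap a]) (x := [false]) rfl h').1 h2
        · rintro rfl
          exact ⟨_, (Piece.rel_cross_iff (X := X) (x := []) rfl (length_dup h')).2
            ⟨_, _, rfl, crossRel_slide_self.2 ⟨rfl, rfl⟩⟩,
            (colorRuns_slideBehind (X := X) (cx := [kMap a]) (x := [false]) rfl h').2 rfl⟩
      · exact colorRuns_slideBehind (cx := [a]) rfl h'
    rw [pullPieces, colorRuns_append]
    simp only [first, exists_eq_left]
    rw [colorRuns_shift (X := X) (cx := [_]) (cy := [_]) rfl rfl]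
    simp only [ih (c := c.map (slid (!d) (if d then a else kMap a))) (by simpa using h')]
    simp [pullColors]

/-- Coloring the pulled strip. -/
theorem exists_coloring_pulledStrip {u : List Bool} {c : List X} (h : c.length = u.length) :
    ∃ F : Coloring X (pulledStrip u), F.level 0 = dup c ∧
      F.level (pulledStrip u).pieces.length = dup c ∧
      F.level (pullPieces u).length = pullColors u c := by
  have r := (colorRuns_pullPieces h).2 rfl
  obtain ⟨L, hL, h0, h1⟩ := r.exists_chain
  -- The lower half of the strip is the reflected pulling, colored by the same words in reverse
  -- order.
  obtain ⟨M, hM, h2, h3⟩ := r.flip.exists_chain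
  obtain ⟨N, hN, h4, h5⟩ := hL.append hM (h1.trans h2.symm)
  have n0 : N 0 = dup c := (h4 0 (Nat.zero_le _)).trans h0
  obtain ⟨F, hF⟩ := Coloring.exists_of_chain (T := pulledStrip u) hN
    (by rw [n0]; exact length_dup h)
  refine ⟨F, (hF 0 (Nat.zero_le _)).trans n0, ?_, ?_⟩
  · rw [hF _ le_rfl, ← h3, ← h5, ← List.length_append]
    rfl
  · rw [hF _ (by simp [pulledStrip]), h4 _ le_rfl, h1]

theorem level_pulledStrip {u : List Bool} {c : List X} (h : c.length = u.length)
    (F : Coloring X (pulledStrip u)) (h0 : F.level 0 = dup c) :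
    F.level (pullPieces u).length = pullColors u c := by
  have r := Chain.colorRuns (ps := pullPieces u) F.chain_level
  rw [h0] at r
  exact (colorRuns_pullPieces h).1 r

end Pull

/-! ### The doubled diagram -/

section Double

variable {X : Type u} [Biquandle X]

/-- The four crossings replacing one crossing of `D`. In the uppermost both sources are upper ends
and in the lowermost both are lower ends, so these two determine the inner colors; the conditions at
the other two reduce to `over_qop`. -/
theorem exists_double_cross {a b o : Bool} {p q p' q' : Qdl X} (h : CrossRel a b o p q p' q') :
    ∃ m₁ m₂ n₁ n₂ : X,
      CrossRel false true (dblOver o (!a) b) p.out q.out m₁ m₂ ∧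
      CrossRel true true (dblOver o a b) p.out m₁ p'.out n₁ ∧
      CrossRel false false (dblOver o (!a) (!b)) m₂ q.out n₂ q'.out ∧
      CrossRel true false (dblOver o a (!b)) n₁ n₂ p'.out q'.out := by
  have e : ∀ x y : Qdl X, Biquandle.ust x y = (qop x.out y.out : X) := fun _ _ => rfl
  have e' : ∀ x y : Qdl X, Biquandle.ost x y = x := fun _ _ => rfl
  have e2 := over_qop (X := X)
  simp only [CrossRel, e, e'] at h
  refine ⟨if dblOver o (!a) b then Biquandle.ust q.out p.out else Biquandle.ost q.out p.out,
    if dblOver o (!a) b then Biquandle.ost p.out q.out else Biquandle.ust p.out q.out,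
    if dblOver o a (!b) then Biquandle.ost q'.out p'.out else Biquandle.ust q'.out p'.out,
    if dblOver o a (!b) then Biquandle.ust p'.out q'.out else Biquandle.ost p'.out q'.out, ?_⟩
  cases a <;> cases b <;> cases o <;>
    simp only [if_true, if_false, Bool.false_eq_true] at h <;>
    obtain ⟨h1, rfl⟩ := h <;> subst h1 <;>
    simp [CrossRel, dblOver, Qdl.out] <;>
    first
    | exact ⟨(e2 _ _).symm, e2 _ _⟩
    | exact ⟨e2 _ _, (e2 _ _).symm⟩

theorem Piece.Rel.colorRuns_double {s : Piece} {w w' : List (Qdl X)} (h : s.Rel w w') :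
    ColorRuns (dupOut w) s.double (dupOut w') := by
  have len : ∀ {x : List (Qdl X)} {l : List Bool}, x.length = l.length →
      (dupOut x).length = (dbl l).length := fun h => length_dup (by simpa using h)
  have app : ∀ x y : List (Qdl X), dupOut (x ++ y) = dupOut x ++ dupOut y := fun x y => by
    simp [dupOut, dup_append]
  have cons : ∀ (x : Qdl X) (y : List (Qdl X)), dupOut (x :: y) = x.out :: x.out :: dupOut y :=
    fun _ _ => rfl
  cases s with
  | cross l r a b o =>
    obtain ⟨x, y, p, q, p', q', hx, hy, rfl, rfl, h⟩ := h
    obtain ⟨m₁, m₂, n₁, n₂, h1, h2, h3, h4⟩ := exists_double_cross h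
    simp only [app, cons]
    refine ⟨dupOut x ++ p.out :: m₁ :: m₂ :: q.out :: dupOut y,
      ⟨dupOut x ++ [p.out], q.out :: dupOut y, _, _, _, _, by simp [len hx], by simp [len hy],
        by simp, by simp, h1⟩,
      dupOut x ++ p'.out :: n₁ :: m₂ :: q.out :: dupOut y,
      ⟨dupOut x, m₂ :: q.out :: dupOut y, _, _, _, _, by simp [len hx], by simp [len hy],
        by simp, by simp, h2⟩,
      dupOut x ++ p'.out :: n₁ :: n₂ :: q'.out :: dupOut y,
      ⟨dupOut x ++ [p'.out, n₁], dupOut y, _, _, _, _, by simp [len hx], by simp [len hy],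
        by simp, by simp, h3⟩,
      _, ⟨dupOut x ++ [p'.out], q'.out :: dupOut y, _, _, _, _, by simp [len hx],
        by simp [len hy], by simp, by simp, h4⟩, rfl⟩
  | birth l r a =>
    obtain ⟨x, y, p, hx, hy, rfl, rfl⟩ := h
    simp only [app, cons]
    exact ⟨_, ⟨dupOut x, dupOut y, p.out, len hx, len hy, rfl, rfl⟩, _,
      ⟨dupOut x ++ [p.out], p.out :: dupOut y, p.out, by simp [len hx], by simp [len hy], by simp,
        rfl⟩, by simp [ColorRuns]⟩
  | death l r a =>
    obtain ⟨x, y, p, hx, hy, rfl, rfl⟩ := h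
    simp only [app, cons]
    exact ⟨_, ⟨dupOut x ++ [p.out], p.out :: dupOut y, p.out, by simp [len hx], by simp [len hy],
      by simp, rfl⟩, _,
      ⟨dupOut x, dupOut y, p.out, len hx, len hy, by simp, rfl⟩, rfl⟩

theorem exists_isDoubling {D : LinkDiagram} (C : QColoring (Qdl X) D) :
    ∃ E : Coloring X D.doubled, IsDoubling C E := by
  obtain ⟨N, hN, h⟩ := Chain.flatMap (ps := D.pieces) Piece.double
    (L := fun j => dupOut (C.toColoring.level j))
    fun j s hs => (Piece.Rel.colorRuns_double (C.toColoring.chain_level j s hs)).exists_chain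
  -- A link diagram has no end points, so the length condition at the top is trivial.
  have h0 : C.toColoring.level 0 = [] := by
    rw [← List.length_eq_zero_iff, Coloring.length_level, D.word_zero]; rfl
  obtain ⟨E, hE⟩ := Coloring.exists_of_chain (T := D.doubled) hN (by
    have := h 0 (Nat.zero_le _)
    simp only [List.take_zero, List.flatMap_nil, List.length_nil] at this
    rw [this, h0]; rfl)
  refine ⟨E, fun j hj => ?_⟩
  rw [hE, ← dupOut_eq]
  · exact h j hj
  · show ((D.pieces.take j).flatMap Piece.double).length ≤ (D.pieces.flatMap Piece.double).length
    conv_rhs => rw [← List.take_append_drop j D.pieces, List.flatMap_append, List.length_append]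
    omega

end Double

/-! ### Comparison of the two descriptions -/

section Comparison

variable {X : Type u} [Biquandle X] {u v : List Bool} {T : Tangle u v}

/-- The link between geometry and algebra: pulling one more copy changes the strings to the right
just as passing to the next gap changes the argument of `psi`. The negation appears because the copy
runs opposite to the string of `D`. -/
theorem slid_psi (p : As (Qdl X)) (d : Bool) (a b : Qdl X) :
    slid (!d) (if d then psi p a else kMap (psi p a)) (psi p b) =
      psi (p * if d then As.of a else (As.of a)⁻¹) b := by
  cases d
  · simp [slid, psi_mul_of_inv]
  · simp [slid, psi_mul_of]

/-- After the first `i` copies have been pulled away, the remaining doubled colors are the original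
ones transformed by `psi` at the color of gap `i`. Keeping `i` general makes the induction on the
number `n` of remaining strings possible. -/
theorem QColoring.drop_level_psiColoring (C : QColoring (Qdl X) T) (j n i : ℕ)
    (h : i + n = (T.word j).length) : (C.psiColoring.level j).drop i =
      pullMain ((T.word j).drop i)
        (((C.toColoring.level j).drop i).map (psi (C.toColoring.gapColor j i))) := by
  induction n generalizing i with
  | zero =>
    rw [List.drop_of_length_le (by rw [Coloring.length_level]; omega),
      List.drop_of_length_le (by omega)]
    simp [pullMain]
  | succ n ih =>
    have hi : i < (T.word j).length := by omega
    let p : T.Point := ⟨j, i, hi⟩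
    rw [List.drop_eq_getElem_cons (by rwa [Coloring.length_level]),
      List.drop_eq_getElem_cons hi,
      List.drop_eq_getElem_cons (l := C.toColoring.level j) (by rwa [Coloring.length_level]),
      ih (i + 1) (by omega), List.map_cons, pullMain, Coloring.getElem_level,
      Coloring.getElem_level, List.map_map, C.toColoring.gapColor_add_one hi]
    have hd : (T.word j)[i] = p.dir := rfl
    congr 1
    · show C.psiColoring.color p.semiArc = _
      rw [C.psiColoring_color, C.toColoring.regionColor_specified, hd, Coloring.sign]
      cases p.dir
      · simp only [if_false, Bool.false_eq_true, psi_mul_of_inv_self]; rfl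
      · simp only [if_true, mul_one]; rfl
    · congr 2
      funext b
      rw [Function.comp_apply, slid_psi, Coloring.sign, hd]

theorem QColoring.level_psiColoring (C : QColoring (Qdl X) T) (j : ℕ) :
    C.psiColoring.level j = pullMain (T.word j) ((C.toColoring.level j).map Qdl.out) := by
  have h := C.drop_level_psiColoring j _ 0 (Nat.zero_add _)
  simp only [List.drop_zero] at h
  rw [h]
  -- The leftmost gap has color `1`, where `psi` is the identity.
  congr 2

theorem isPullingAwayMap_psiColoring (X : Type u) [Biquandle X] (D : LinkDiagram) :
    IsPullingAwayMap (QColoring.psiColoring (X := X) (T := D)) := by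
  intro C C'
  have hl : ∀ j, ((C.toColoring.level j).map Qdl.out).length = (D.word j).length := fun j => by
    rw [List.length_map, Coloring.length_level]
  constructor
  · rintro rfl
    obtain ⟨E, hE⟩ := exists_isDoubling C
    refine ⟨E, hE, fun j hj => ?_⟩
    obtain ⟨F, h0, h1, h2⟩ := exists_coloring_pulledStrip (hl j)
    rw [hE j hj, ← dupOut_eq]
    exact ⟨F, h0, h1, by rw [h2, (take_pullColors (hl j)).1, C.level_psiColoring]⟩
  · rintro ⟨E, hE, h⟩
    -- Any doubling `E` has the same words at the doubled levels, and these determine the middle of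
    -- every pulled strip; hence the outcome does not depend on `E` or `F`.
    refine Coloring.ext_level fun j hj => ?_
    obtain ⟨F, h0, -, h2⟩ := h j hj
    rw [hE j hj, ← dupOut_eq] at h0
    rw [← h2, level_pulledStrip (hl j) F h0, (take_pullColors (hl j)).1, C.level_psiColoring]

end Comparison

end KnotColor

open KnotColor in
theorem proposition6p2 (X : Type u) [Biquandle X] (D : LinkDiagram) :
    ∃ Ψ : QColoring (Qdl X) D ≃ Coloring X D,
      IsPullingAwayMap Ψ ∧
      ∀ C : QColoring (Qdl X) D,
        (Ψ C).shadow = psiTilde ∘ C.toColoring.shadow :=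
  ⟨psiColoringEquiv X D, isPullingAwayMap_psiColoring X D, QColoring.shadow_psiColoring⟩
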